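/- Consider the following parameterized problem, Vertex Cover Below Tight Upper Bound-2 (VCU2). Instance: a finite simple graph $G=(V,E)$, a maximal matching $M$ of $G$ (a matching that is not properly contained in another matching of $G$), and a positive integer $k$. Parameter: $k$. Question: does $G$ have a vertex cover $C$ with $|C|\le 2|M|-k$? Theorem. VCU2 is W[1]-hard; that is, every parameterized problem in the class W[1] is fixed-parameter reducible to VCU2. Here a parameterized problem $P$ is fixed-parameter reducible to a parameterized problem $Q$ if there are computable functions $f,g:\mathbb N\to\mathbb N$, a constant $c$, and an algorithm that maps every pair $(x,k)$ to a pair $(x',k')$ in at most $f(k)\,(|x|+1)^{c}$ steps, such that $k'\le g(k)$ and $(x,k)\in P\iff (x',k')\in Q$. The class W[1] consists of the parameterized problems that are, for some constant $h$, fixed-parameter reducible to the following problem: given a Boolean circuit of weft at most $1$ and depth at most $h$ and a parameter $k$, does the circuit have a satisfying assignment that sets exactly $k$ inputs to true? (The weft is the maximum number of gates of fan-in greater than two on a path to the output; the depth is the maximum number of gates on such a path.) -/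

import Mathlib

/-! ## Random access machines with a step count

The machine model is the random access machine with uniform cost and with addition and cut-off
subtraction as its arithmetic, programmed with structured control. The memory is split into
countably many arrays of natural numbers, of which a program can mention only finitely many. -/

/-- `m a i` is the content of cell `i` of array `a`. -/
abbrev Memory := ℕ → ℕ → ℕ

/-- Expressions; `read a i` is an indirect access to cell `i` of array `a`. -/
inductive Expr where
  | const (c : ℕ)
  | read (a : ℕ) (i : Expr)
  | add (e₁ e₂ : Expr)
  | sub (e₁ e₂ : Expr)

def Expr.eval (m : Memory) : Expr → ℕ
  | const c => c
  | read a i => m a (i.eval m)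
  | add e₁ e₂ => e₁.eval m + e₂.eval m
  | sub e₁ e₂ => e₁.eval m - e₂.eval m

/-- Programs. `assign a i e` stores the value of `e` in cell `i` of array `a`; `ite` and `loop`
test whether the value of an expression is nonzero. -/
inductive Program where
  | skip
  | assign (a : ℕ) (i e : Expr)
  | seq (p q : Program)
  | ite (e : Expr) (p q : Program)
  | loop (e : Expr) (p : Program)

/-- `Exec p m m' t`: started on memory `m`, the program `p` halts after `t` steps with memory `m'`.
Every assignment and every test is one step (a fixed program has finitely many expressions, so
each step is a bounded number of elementary machine operations). -/
inductive Exec : Program → Memory → Memory → ℕ → Prop where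
  | skip (m : Memory) : Exec .skip m m 1
  | assign (a : ℕ) (i e : Expr) (m : Memory) :
      Exec (.assign a i e) m
        (Function.update m a (Function.update (m a) (i.eval m) (e.eval m))) 1
  | seq {p q : Program} {m m' m'' : Memory} {s t : ℕ} :
      Exec p m m' s → Exec q m' m'' t → Exec (.seq p q) m m'' (s + t)
  | ite_true {e : Expr} {p q : Program} {m m' : Memory} {t : ℕ} :
      e.eval m ≠ 0 → Exec p m m' t → Exec (.ite e p q) m m' (t + 1)
  | ite_false {e : Expr} {p q : Program} {m m' : Memory} {t : ℕ} :
      e.eval m = 0 → Exec q m m' t → Exec (.ite e p q) m m' (t + 1)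
  | loop_stop {e : Expr} {p : Program} {m : Memory} :
      e.eval m = 0 → Exec (.loop e p) m m 1
  | loop_step {e : Expr} {p : Program} {m m' m'' : Memory} {s t : ℕ} :
      e.eval m ≠ 0 → Exec p m m' s → Exec (.loop e p) m' m'' t →
        Exec (.loop e p) m m'' (s + t + 1)

/-- The content of cell `i` of an array that holds the binary word `x`: the letters are
represented by `1` and `2`, and the cells after the end of the word hold `0`. -/
def cellCode (x : List Bool) (i : ℕ) : ℕ :=
  match x[i]? with
  | none => 0
  | some false => 1
  | some true => 2

/-- Initial memory: array `0` holds the word `x`, cell `0` of array `1` holds the number `k`, all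
other cells are `0`. -/
def initMemory (x : List Bool) (k : ℕ) : Memory := fun a i =>
  if a = 0 then cellCode x i else if a = 1 ∧ i = 0 then k else 0

/-- Output convention: array `2` holds a word, with a `0` after its last letter, and cell `0` of
array `3` holds a number. Nothing is required of the rest of the memory. -/
def HoldsOutput (m : Memory) (y : List Bool) (l : ℕ) : Prop :=
  (∀ i ≤ y.length, m 2 i = cellCode y i) ∧ m 3 0 = l

/-! ## Parameterized problems and fixed-parameter reductions -/

/-- A parameterized problem is a set of pairs (main part, parameter), the main part being a word
over a fixed finite alphabet. -/
abbrev ParamProblem := Set (List Bool × ℕ)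

/-- Many-one fixed-parameter reducibility: some map `r` preserves and reflects membership, its
new parameter is bounded by a computable function of the old one, and it is computed by a program
in time `f(k) * |x|^O(1)` for a computable function `f`. -/
def FPTReducible (P Q : ParamProblem) : Prop :=
  ∃ (r : List Bool × ℕ → List Bool × ℕ) (p : Program) (f g : ℕ → ℕ) (c : ℕ),
    Computable f ∧ Computable g ∧
    (∀ x k, (x, k) ∈ P ↔ r (x, k) ∈ Q) ∧
    (∀ x k, (r (x, k)).2 ≤ g k) ∧
    (∀ x k, ∃ (m : Memory) (t : ℕ), Exec p (initMemory x k) m t ∧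
      HoldsOutput m (r (x, k)).1 (r (x, k)).2 ∧ t ≤ f k * (x.length + 1) ^ c)

/-! ## Encodings -/

/-- The number `n` as a self-delimiting word: `n` ones and a zero. -/
def encodeNat (n : ℕ) : List Bool := List.replicate n true ++ [false]

open scoped Classical in
/-- A binary relation on `Fin n` as a 0-1-matrix, row by row. -/
noncomputable def encodeMatrix {n : ℕ} (R : Fin n → Fin n → Prop) : List Bool :=
  (List.finRange n).flatMap fun i => (List.finRange n).map fun j => decide (R i j)

/-! ## Boolean circuits and the classes of the W-hierarchy -/

/-- The kinds of nodes of a circuit. -/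
inductive NodeKind where
  | input
  | notGate
  | andGate
  | orGate

/-- A circuit with one output: a directed acyclic graph on the nodes `0, …, last`, given in a
topological order, whose output is the node `last`. Input nodes have no incoming wire, negation
gates have exactly one, and the other gates have at least one. -/
structure Circuit where
  last : ℕ
  kind : Fin (last + 1) → NodeKind
  wire : Fin (last + 1) → Fin (last + 1) → Prop
  lt_of_wire : ∀ i j, wire i j → i < j
  no_wire_to_input : ∀ i j, kind j = .input → ¬ wire i j
  existsUnique_of_not : ∀ j, kind j = .notGate → ∃! i, wire i j
  exists_of_and : ∀ j, kind j = .andGate → ∃ i, wire i j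
  exists_of_or : ∀ j, kind j = .orGate → ∃ i, wire i j

namespace Circuit

/-- `v` is the family of truth values that the nodes get under some truth assignment to the
inputs (acyclicity makes the values at the inputs determine all others). -/
def IsValuation (C : Circuit) (v : Fin (C.last + 1) → Prop) : Prop :=
  ∀ j, match C.kind j with
    | .input => True
    | .notGate => v j ↔ ∃ i, C.wire i j ∧ ¬ v i
    | .andGate => v j ↔ ∀ i, C.wire i j → v i
    | .orGate => v j ↔ ∃ i, C.wire i j ∧ v i

/-- `C` has a satisfying assignment of weight exactly `k`, i.e. one that sets exactly `k` inputs
to true. -/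
def HasWeightedSat (C : Circuit) (k : ℕ) : Prop :=
  ∃ v : Fin (C.last + 1) → Prop, C.IsValuation v ∧ v (Fin.last C.last) ∧
    {i | C.kind i = .input ∧ v i}.ncard = k

/-- A directed path that ends in the output. Every such path extends backwards to one that starts
in an input. -/
def IsPathToOutput (C : Circuit) (p : List (Fin (C.last + 1))) : Prop :=
  p.IsChain C.wire ∧ p.getLast? = some (Fin.last C.last)

/-- A gate is large if its fan-in exceeds two. -/
def IsLarge (C : Circuit) (j : Fin (C.last + 1)) : Prop :=
  2 < {i | C.wire i j}.ncard

open scoped Classical in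
/-- Every path to the output contains at most `h` gates. -/
def DepthLE (C : Circuit) (h : ℕ) : Prop :=
  ∀ p, C.IsPathToOutput p → p.countP (fun j => decide (C.kind j ≠ .input)) ≤ h

open scoped Classical in
/-- Every path to the output contains at most `t` large gates. -/
def WeftLE (C : Circuit) (t : ℕ) : Prop :=
  ∀ p, C.IsPathToOutput p → p.countP (fun j => decide (C.IsLarge j)) ≤ t

def encodeKind : NodeKind → List Bool
  | .input => [false, false]
  | .notGate => [false, true]
  | .andGate => [true, false]
  | .orGate => [true, true]

/-- The number of nodes, the kinds of the nodes, and the adjacency matrix of the wires. -/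
noncomputable def encode (C : Circuit) : List Bool :=
  encodeNat (C.last + 1) ++
    (List.finRange (C.last + 1)).flatMap (fun i => encodeKind (C.kind i)) ++
    encodeMatrix C.wire

end Circuit

/-- Weighted circuit satisfiability for circuits of weft at most `t` and depth at most `h`,
parameterized by the weight. -/
def weightedCircuitSat (t h : ℕ) : ParamProblem :=
  {q | ∃ C : Circuit, C.WeftLE t ∧ C.DepthLE h ∧ q.1 = C.encode ∧ C.HasWeightedSat q.2}

/-- The class W[t]: the parameterized problems that are fixed-parameter reducible to weighted
satisfiability of weft-`t` circuits of depth at most `h`, for some constant `h`. -/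
def WClass (t : ℕ) : Set ParamProblem :=
  {P | ∃ h, FPTReducible P (weightedCircuitSat t h)}

/-- `Q` is W[t]-hard: every problem in W[t] is fixed-parameter reducible to `Q`. -/
def WHard (t : ℕ) (Q : ParamProblem) : Prop :=
  ∀ P ∈ WClass t, FPTReducible P Q

/-! ## Vertex Cover Below Tight Upper Bound-2 -/

/-- `M` is a matching of `G` that is not properly contained in another matching of `G`. -/
def IsMaximalMatching {V : Type*} {G : SimpleGraph V} (M : G.Subgraph) : Prop :=
  Maximal (fun M' : G.Subgraph => M'.IsMatching) M

/-- The number of vertices and the adjacency matrices of `G` and of the matching `M`. -/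
noncomputable def encodeVCU2 {n : ℕ} (G : SimpleGraph (Fin n)) (M : G.Subgraph) : List Bool :=
  encodeNat n ++ encodeMatrix G.Adj ++ encodeMatrix M.Adj

/-- Instance: a graph `G`, a maximal matching `M` of `G` and a positive integer `k`.
Parameter: `k`. Question: is there a vertex cover of `G` with at most `2|M| - k` vertices?
(The inequality is written without subtraction.) -/
def VCU2 : ParamProblem :=
  {q | 0 < q.2 ∧ ∃ (n : ℕ) (G : SimpleGraph (Fin n)) (M : G.Subgraph),
    IsMaximalMatching M ∧ q.1 = encodeVCU2 G M ∧
    ∃ C : Finset (Fin n), G.IsVertexCover (C : Set (Fin n)) ∧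
      C.card + q.2 ≤ 2 * M.edgeSet.ncard}

/-! ## Polynomial-time functions on the random access machine -/

/-! If M is a perfect matching, then 2|M| is the number of vertices, and a cover with at most 2|M| -
k vertices is the complement of an independent set with at least k vertices. A graph on N vertices
becomes perfectly matched by adding N vertices adjacent to everything, and these are useless for
independent sets of size at least two. So it suffices to express weighted satisfiability of circuits
of weft 1 and depth h by independent sets of size (k + 2)^Q in a graph of polynomial size, where Q
depends on h only.

The core is a locality property. A proof that the output is true (`Circuit.Ev`) picks one child at
every existential gate, that is, at a disjunction to be made true or a conjunction to be made false.
Since the weft is 1, at most 2^h picks at large gates are needed (`Circuit.exists_ev`); they form a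
set W. Once W is fixed, an existential gate has at most 2^h + 2 admissible children, and the failure
of a universal gate is explained by one child. So if there is no proof, at most (2^h + 2)^h inputs
are to blame (`Circuit.exists_finset_of_not_ev`).

List the k true inputs increasingly between two sentinels, in k + 2 slots. That an input is true is
visible in one slot, that it is false in two adjacent slots enclosing it. So Q = 2(2^h + 2)^h slots
show the values of any (2^h + 2)^h inputs. A vertex gives the contents of Q slots and a guess of W
that these contents do not refute. Two vertices are joined if they have the same tuple of slots,
different guesses or contradictory contents. By pigeonhole an independent set of size (k + 2)^Q has
one vertex for every tuple, so its contents glue to one list and one W, and locality yields a proof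
that the output is true (`mem_of_independent`). Conversely, a satisfying assignment provides all
these vertices (`exists_independent_of_mem`).

For the running time, polynomial-time functions are closed under bounded sums (`PolyTime.sum`),
hence under the arithmetic and the bounded quantifiers that define the graph.
`FPTReducible.trans_polyTime` composes the construction with a given reduction. -/

theorem Exec.exists_loop {e : Expr} {body : Program} (Inv : ℕ → Memory → Prop) (N T : ℕ)
    (step : ∀ i < N, ∀ m, Inv i m →
      e.eval m ≠ 0 ∧ ∃ m' t, Exec body m m' t ∧ Inv (i + 1) m' ∧ t ≤ T)
    (halt : ∀ m, Inv N m → e.eval m = 0) {m : Memory} (h : Inv 0 m) :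
    ∃ m' t, Exec (.loop e body) m m' t ∧ Inv N m' ∧ t ≤ N * (T + 1) + 1 := by
  suffices H : ∀ r i, i + r = N → ∀ m, Inv i m →
      ∃ m' t, Exec (.loop e body) m m' t ∧ Inv N m' ∧ t ≤ r * (T + 1) + 1 from
    H N 0 (by simp) m h
  intro r
  induction r with
  | zero =>
    intro i hi m hm
    obtain rfl : i = N := by omega
    exact ⟨m, 1, Exec.loop_stop (halt m hm), hm, by omega⟩
  | succ r ih =>
    intro i hi m hm
    obtain ⟨he, m1, t1, h1, i1, l1⟩ := step i (by omega) m hm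
    obtain ⟨m2, t2, h2, i2, l2⟩ := ih (i + 1) (by omega) m1 i1
    exact ⟨m2, t1 + t2 + 1, .loop_step he h1 h2, i2, by nlinarith⟩

/-- A program touches at most as many cells of an array as it makes steps. -/
theorem Exec.exists_support {p : Program} {m m' : Memory} {t : ℕ} (h : Exec p m m' t) (b : ℕ) :
    ∃ S : Finset ℕ, S.card ≤ t ∧ ∀ i ∉ S, m' b i = m b i := by
  induction h with
  | skip m => exact ⟨∅, by simp, fun i _ => rfl⟩
  | assign a i e m =>
    refine ⟨{i.eval m}, by simp, fun j hj => ?_⟩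
    by_cases hb : b = a
    · subst hb
      simp only [Function.update_self]
      rw [Function.update_of_ne (by simpa using hj)]
    · rw [Function.update_of_ne hb]
  | seq _ _ ih1 ih2 =>
    obtain ⟨S, hS, h1⟩ := ih1
    obtain ⟨S', hS', h2⟩ := ih2
    refine ⟨S ∪ S', (Finset.card_union_le _ _).trans (by omega), fun i hi => ?_⟩
    rw [Finset.notMem_union] at hi
    rw [h2 i hi.2, h1 i hi.1]
  | ite_true _ _ ih | ite_false _ _ ih =>
    obtain ⟨S, hS, h1⟩ := ih
    exact ⟨S, by omega, h1⟩
  | loop_stop _ => exact ⟨∅, by simp, fun i _ => rfl⟩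
  | loop_step _ _ _ ih1 ih2 =>
    obtain ⟨S, hS, h1⟩ := ih1
    obtain ⟨S', hS', h2⟩ := ih2
    refine ⟨S ∪ S', (Finset.card_union_le _ _).trans (by omega), fun i hi => ?_⟩
    rw [Finset.notMem_union] at hi
    rw [h2 i hi.2, h1 i hi.1]

theorem cellCode_ne_zero_iff {x : List Bool} {i : ℕ} : cellCode x i ≠ 0 ↔ i < x.length := by
  unfold cellCode
  rcases lt_or_ge i x.length with h | h
  · rw [List.getElem?_eq_getElem h]
    cases x[i] <;> simp [h]
  · rw [List.getElem?_eq_none h]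
    simp [h]

theorem cellCode_le (x : List Bool) (i : ℕ) : cellCode x i ≤ 2 := by
  unfold cellCode
  split <;> simp

theorem cellCode_append_left {x y : List Bool} {i : ℕ} (h : i < x.length) :
    cellCode (x ++ y) i = cellCode x i := by
  simp [cellCode, List.getElem?_append_left h]

theorem cellCode_append_right {x y : List Bool} {i : ℕ} (h : x.length ≤ i) :
    cellCode (x ++ y) i = cellCode y (i - x.length) := by
  simp [cellCode, List.getElem?_append_right h]

/-- Instances: a word and a parameter. -/
structure Inst where
  word : List Bool
  param : ℕ

/-- Types whose elements consist of an instance and finitely many numbers. -/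
class Ctx (α : Type) where
  depth : ℕ
  inst : α → Inst
  var : α → ℕ → ℕ

instance : Ctx Inst where
  depth := 0
  inst := id
  var _ _ := 0

/-- This brings the bound variable of a sum or quantifier into scope: it gets the index `depth α`,
and the older indices keep their meaning. -/
instance {α : Type} [Ctx α] : Ctx (α × ℕ) where
  depth := Ctx.depth α + 1
  inst a := Ctx.inst a.1
  var a j := if j = Ctx.depth α then a.2 else Ctx.var a.1 j

/-! ### Contexts and their representation in memory -/

namespace Ctx

variable {α : Type} [Ctx α]

/-- The summand 2 lets powers of the size dominate all constants. -/
def size (a : α) : ℕ :=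
  (inst a).word.length + (inst a).param + 2 + ∑ j ∈ Finset.range (depth α), var a j

theorem two_le_size (a : α) : 2 ≤ size a := by
  unfold size; omega

theorem size_pair (a : α) (i : ℕ) : size (a, i) = size a + i := by
  have h1 : inst (a, i) = inst a := rfl
  have h2 : depth (α × ℕ) = depth α + 1 := rfl
  have h3 : ∀ j, var (a, i) j = if j = depth α then i else var a j := fun _ => rfl
  simp only [size, h1, h2, h3, Finset.sum_range_succ, if_true]
  rw [Finset.sum_congr rfl fun j hj => if_neg (Finset.mem_range.1 hj).ne]
  exact (add_assoc _ _ _).symm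

/-- The memory `m` holds `a`: array `4` holds the word, array `5` its length, array `6` the
parameter, and array `7 + ρ j` the `j`-th of the other numbers. -/
def Holds (ρ : ℕ → ℕ) (m : Memory) (a : α) : Prop :=
  (∀ i < (inst a).word.length, m 4 i = cellCode (inst a).word i) ∧
    m 5 0 = (inst a).word.length ∧ m 6 0 = (inst a).param ∧
    ∀ j < depth α, m (7 + ρ j) 0 = var a j

/-- Programs write only to fresh scalars and to the output arrays `2` and `3`, so the arguments
survive. -/
theorem Holds.congr {ρ : ℕ → ℕ} {d : ℕ} {m m' : Memory} {a : α} (h : Holds ρ m a)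
    (hρ : ∀ j < depth α, ρ j < d) (hm : ∀ b, 4 ≤ b → b < 7 + d → m' b = m b) :
    Holds ρ m' a := by
  obtain ⟨h1, h2, h3, h4⟩ := h
  refine ⟨?_, ?_, ?_, fun j hj => ?_⟩
  · rwa [hm 4 (by omega) (by omega)]
  · rwa [hm 5 (by omega) (by omega)]
  · rwa [hm 6 (by omega) (by omega)]
  · have := hρ j hj
    rw [hm _ (by omega) (by omega), h4 j hj]

/-- A loop counter in scalar `d` becomes the last coordinate of the extended context. -/
theorem Holds.push {ρ : ℕ → ℕ} {d i : ℕ} {m : Memory} {a : α} (h : Holds ρ m a)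
    (hi : m (7 + d) 0 = i) : Holds (Function.update ρ (depth α) d) m (a, i) := by
  obtain ⟨h1, h2, h3, h4⟩ := h
  refine ⟨h1, h2, h3, fun j hj => ?_⟩
  have hj' : j < depth α + 1 := hj
  change _ = if j = depth α then i else var a j
  split_ifs with hjd
  · subst hjd
    rwa [Function.update_self]
  · rw [Function.update_of_ne hjd]
    exact h4 j (by omega)

theorem update_lt {ρ : ℕ → ℕ} {d e : ℕ} (hρ : ∀ j < depth α, ρ j < d) (hd : d < e) :
    ∀ j < depth (α × ℕ), Function.update ρ (depth α) d j < e := by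
  intro j hj
  have hj' : j < depth α + 1 := hj
  by_cases hjd : j = depth α
  · subst hjd
    rwa [Function.update_self]
  · rw [Function.update_of_ne hjd]
    exact (hρ j (by omega)).trans hd

end Ctx

open Ctx

section Framework

variable {α : Type} [Ctx α]

/-- Polynomially bounded functions. -/
def PolyBounded (T : α → ℕ) : Prop := ∃ c, ∀ a, T a ≤ size a ^ c

namespace PolyBounded

theorem mono {T T' : α → ℕ} (h : PolyBounded T') (hle : ∀ a, T a ≤ T' a) : PolyBounded T :=
  h.imp fun _ hc a => (hle a).trans (hc a)

theorem const (c : ℕ) : PolyBounded (fun _ : α => c) :=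
  ⟨c, fun a => Nat.lt_two_pow_self.le.trans (Nat.pow_le_pow_left (two_le_size a) c)⟩

theorem size : PolyBounded (fun a : α => size a) := ⟨1, fun a => by simp⟩

theorem add {T T' : α → ℕ} : PolyBounded T → PolyBounded T' →
    PolyBounded (fun a => T a + T' a) := by
  rintro ⟨c, hc⟩ ⟨c', hc'⟩
  refine ⟨c + c' + 1, fun a => ?_⟩
  have h2 := two_le_size a
  have h3 : Ctx.size a ^ c ≤ Ctx.size a ^ (c + c') := Nat.pow_le_pow_right (by omega) (by omega)
  have h4 : Ctx.size a ^ c' ≤ Ctx.size a ^ (c + c') := Nat.pow_le_pow_right (by omega) (by omega)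
  have := hc a
  have := hc' a
  rw [pow_succ]
  nlinarith

theorem mul {T T' : α → ℕ} : PolyBounded T → PolyBounded T' →
    PolyBounded (fun a => T a * T' a) := by
  rintro ⟨c, hc⟩ ⟨c', hc'⟩
  exact ⟨c + c', fun a => by rw [pow_add]; exact Nat.mul_le_mul (hc a) (hc' a)⟩

theorem pow {T : α → ℕ} (h : PolyBounded T) (c : ℕ) : PolyBounded (fun a => T a ^ c) := by
  induction c with
  | zero => simpa using const 1
  | succ c ih => simpa only [pow_succ] using ih.mul h

/-- This bounds the cost of a loop body uniformly over the values of the counter. -/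
theorem subst {T : α × ℕ → ℕ} {b : α → ℕ} (hT : PolyBounded T) (hb : PolyBounded b) :
    ∃ T', PolyBounded T' ∧ ∀ a, ∀ i ≤ b a, T (a, i) ≤ T' a := by
  obtain ⟨c, hc⟩ := hT
  refine ⟨fun a => (Ctx.size a + b a) ^ c, (size.add hb).pow c, fun a i hi => ?_⟩
  refine (hc _).trans ?_
  rw [size_pair]
  exact Nat.pow_le_pow_left (by omega) c

end PolyBounded

/-- The functions that are polynomially bounded and computable in polynomial time. The program
for `f` finds its arguments at the places `ρ`, uses no scalar below `d` and leaves the value in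
scalar `d`. -/
def PolyTime (f : α → ℕ) : Prop :=
  PolyBounded f ∧ ∀ (ρ : ℕ → ℕ) (d : ℕ), (∀ j < depth α, ρ j < d) →
    ∃ (p : Program) (T : α → ℕ), PolyBounded T ∧ ∀ a m, Holds ρ m a →
      ∃ m' t, Exec p m m' t ∧ m' (7 + d) 0 = f a ∧ (∀ b < 7 + d, m' b = m b) ∧ t ≤ T a

/-- The scalar `d`. -/
abbrev Expr.scalar (d : ℕ) : Expr := .read (7 + d) (.const 0)

/-- Assignment to the scalar `d`. -/
abbrev Program.set (d : ℕ) (e : Expr) : Program := .assign (7 + d) (.const 0) e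

abbrev Memory.set (m : Memory) (d v : ℕ) : Memory :=
  Function.update m (7 + d) (Function.update (m (7 + d)) 0 v)

theorem Exec.set (d : ℕ) (e : Expr) (m : Memory) :
    Exec (.set d e) m (m.set d (e.eval m)) 1 := Exec.assign _ _ _ _

theorem Memory.set_self (m : Memory) (d v : ℕ) : m.set d v (7 + d) 0 = v := by
  simp [Memory.set]

theorem Memory.set_of_ne (m : Memory) {d v b : ℕ} (h : b ≠ 7 + d) : m.set d v b = m b := by
  simp [Memory.set, h]

theorem polyTime_of_expr {f : α → ℕ} (hf : PolyBounded f)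
    (h : ∀ ρ : ℕ → ℕ, ∃ e : Expr, ∀ a m, Holds ρ m a → e.eval m = f a) : PolyTime f := by
  refine ⟨hf, fun ρ d _ => ?_⟩
  obtain ⟨e, he⟩ := h ρ
  refine ⟨.set d e, fun _ => 1, .const 1, fun a m ha => ⟨_, 1, Exec.set _ _ _, ?_, ?_, le_rfl⟩⟩
  · rw [Memory.set_self, he a m ha]
  · intro b hb
    exact Memory.set_of_ne _ (by omega)

/-! ### Closure properties of polynomial-time functions -/

namespace PolyTime

theorem congr {f g : α → ℕ} (hf : PolyTime f) (h : ∀ a, g a = f a) : PolyTime g := by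
  rwa [show g = f from funext h]

theorem const (c : ℕ) : PolyTime (fun _ : α => c) :=
  polyTime_of_expr (.const c) fun _ => ⟨.const c, fun _ _ _ => rfl⟩

theorem length : PolyTime (fun a : α => (inst a).word.length) :=
  polyTime_of_expr (PolyBounded.size.mono fun a => by unfold Ctx.size; omega)
    fun _ => ⟨.read 5 (.const 0), fun _ _ h => h.2.1⟩

theorem param : PolyTime (fun a : α => (inst a).param) :=
  polyTime_of_expr (PolyBounded.size.mono fun a => by unfold Ctx.size; omega)
    fun _ => ⟨.read 6 (.const 0), fun _ _ h => h.2.2.1⟩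

theorem snd : PolyTime (fun a : α × ℕ => a.2) :=
  polyTime_of_expr (PolyBounded.size.mono fun a => by rw [← Prod.mk.eta (p := a), size_pair]; simp)
    fun ρ => ⟨.scalar (ρ (depth α)), fun a m h => by
      have := h.2.2.2 (depth α) (Nat.lt_succ_self _)
      exact this.trans (if_pos rfl)⟩

theorem fst {f : α → ℕ} (hf : PolyTime f) : PolyTime (fun a : α × ℕ => f a.1) := by
  have key : ∀ T : α → ℕ, PolyBounded T → PolyBounded (fun a : α × ℕ => T a.1) := by
    rintro T ⟨c, hc⟩
    refine ⟨c, fun a => (hc _).trans (Nat.pow_le_pow_left ?_ c)⟩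
    rw [← Prod.mk.eta (p := a), size_pair]
    simp
  refine ⟨key _ hf.1, fun ρ d hρ => ?_⟩
  have hd : ∀ j < depth α, j < depth (α × ℕ) := fun j hj => Nat.lt_succ_of_lt hj
  obtain ⟨p, T, hT, H⟩ := hf.2 ρ d fun j hj => hρ j (hd j hj)
  refine ⟨p, _, key _ hT, fun a m h => H a.1 m ⟨h.1, h.2.1, h.2.2.1, fun j hj => ?_⟩⟩
  have := h.2.2.2 j (hd j hj)
  exact this.trans (if_neg hj.ne)

theorem map₂ {F : ℕ → ℕ → ℕ} (op : Expr → Expr → Expr)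
    (hop : ∀ e₁ e₂ m, (op e₁ e₂).eval m = F (e₁.eval m) (e₂.eval m)) {f g : α → ℕ}
    (hF : PolyBounded fun a => F (f a) (g a)) (hf : PolyTime f) (hg : PolyTime g) :
    PolyTime (fun a => F (f a) (g a)) := by
  refine ⟨hF, fun ρ d hρ => ?_⟩
  obtain ⟨p, T, hT, H⟩ := hf.2 ρ d hρ
  -- The second program works above scalar `d`, where the value of `f` is kept.
  obtain ⟨p', T', hT', H'⟩ := hg.2 ρ (d + 1) fun j hj => (hρ j hj).trans (Nat.lt_succ_self d)
  refine ⟨.seq p (.seq p' (.set d (op (.scalar d) (.scalar (d + 1))))), _,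
    hT.add (hT'.add (.const 1)), fun a m ha => ?_⟩
  obtain ⟨m1, t1, e1, v1, s1, l1⟩ := H a m ha
  obtain ⟨m2, t2, e2, v2, s2, l2⟩ := H' a m1 (ha.congr hρ fun b _ hb => s1 b hb)
  refine ⟨_, _, e1.seq (e2.seq (Exec.set _ _ _)), ?_, ?_, by omega⟩
  · rw [Memory.set_self, hop]
    simp only [Expr.eval]
    rw [v2, s2 _ (by omega), v1]
  · intro b hb
    rw [Memory.set_of_ne _ (by omega), s2 b (by omega), s1 b hb]

theorem add {f g : α → ℕ} (hf : PolyTime f) (hg : PolyTime g) :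
    PolyTime (fun a => f a + g a) :=
  map₂ .add (fun _ _ _ => rfl) (hf.1.add hg.1) hf hg

theorem sub {f g : α → ℕ} (hf : PolyTime f) (hg : PolyTime g) :
    PolyTime (fun a => f a - g a) :=
  map₂ .sub (fun _ _ _ => rfl) (hf.1.mono fun _ => Nat.sub_le _ _) hf hg

/-- The test of the bound is needed since `Holds` leaves array `4` arbitrary beyond the word, where
`cellCode` is 0. -/
theorem cell {f : α → ℕ} (hf : PolyTime f) :
    PolyTime (fun a => cellCode (inst a).word (f a)) := by
  refine ⟨(PolyBounded.const 2).mono fun _ => cellCode_le _ _, fun ρ d hρ => ?_⟩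
  obtain ⟨p, T, hT, H⟩ := hf.2 ρ d hρ
  refine ⟨.seq p (.ite (.sub (.read 5 (.const 0)) (.scalar d)) (.set d (.read 4 (.scalar d)))
    (.set d (.const 0))), _, hT.add (.const 2), fun a m ha => ?_⟩
  obtain ⟨m1, t1, e1, v1, s1, l1⟩ := H a m ha
  obtain ⟨h1, h2, -⟩ := ha.congr hρ fun b _ hb => s1 b hb
  have he : (Expr.sub (.read 5 (.const 0)) (.scalar d)).eval m1 =
      (inst a).word.length - f a := by
    simp only [Expr.eval]; rw [h2, v1]
  have hs : ∀ e : Expr, ∀ b < 7 + d, m1.set d (e.eval m1) b = m b := fun e b hb => by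
    rw [Memory.set_of_ne _ (by omega), s1 b hb]
  by_cases hlt : f a < (inst a).word.length
  · refine ⟨_, _, e1.seq (.ite_true (by rw [he]; omega) (Exec.set _ _ _)), ?_, hs _, by omega⟩
    rw [Memory.set_self]
    simp only [Expr.eval]
    rw [v1, h1 _ hlt]
  · refine ⟨_, _, e1.seq (.ite_false (by rw [he]; omega) (Exec.set _ _ _)), ?_, hs _, by omega⟩
    rw [Memory.set_self]
    by_contra hne
    exact hlt (cellCode_ne_zero_iff.1 (Ne.symm hne))

/-- The only source of iteration for functions: products, quotients and bounded quantifiers are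
derived from it. -/
theorem sum {b : α → ℕ} {f : α → ℕ → ℕ} (hb : PolyTime b)
    (hf : PolyTime fun q : α × ℕ => f q.1 q.2) :
    PolyTime (fun a => ∑ i ∈ Finset.range (b a), f a i) := by
  obtain ⟨B, hB, hfB⟩ := hf.1.subst hb.1
  refine ⟨(hb.1.mul hB).mono fun a => ?_, fun ρ d hρ => ?_⟩
  · refine (Finset.sum_le_card_nsmul _ _ (B a) fun i hi => ?_).trans (by simp)
    exact hfB a i (Finset.mem_range.1 hi).le
  obtain ⟨p, T, hT, H⟩ := hb.2 ρ (d + 1) fun j hj => (hρ j hj).trans (Nat.lt_succ_self d)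
  obtain ⟨p', T', hT', H'⟩ := hf.2 (Function.update ρ (depth α) (d + 2)) (d + 3)
    (update_lt (fun j hj => (hρ j hj).trans (by omega)) (by omega))
  obtain ⟨T'', hT'', hTT⟩ := hT'.subst hb.1
  -- scalars: `d` accumulator, `d + 1` bound, `d + 2` counter, `d + 3` summand
  refine ⟨.seq p (.seq (.set d (.const 0)) (.seq (.set (d + 2) (.const 0))
    (.loop (.sub (.scalar (d + 1)) (.scalar (d + 2)))
      (.seq p' (.seq (.set d (.add (.scalar d) (.scalar (d + 3))))
        (.set (d + 2) (.add (.scalar (d + 2)) (.const 1)))))))), _,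
    (hT.add (.const 2)).add ((hb.1.mul ((hT''.add (.const 2)).add (.const 1))).add (.const 1)),
    fun a m ha => ?_⟩
  obtain ⟨m1, t1, e1, v1, s1, l1⟩ := H a m ha
  let Inv : ℕ → Memory → Prop := fun i m' =>
    m' (7 + d) 0 = ∑ i ∈ Finset.range i, f a i ∧ m' (7 + (d + 1)) 0 = b a ∧
      m' (7 + (d + 2)) 0 = i ∧ ∀ b < 7 + d, m' b = m b
  have hInv0 : Inv 0 ((m1.set d 0).set (d + 2) 0) := by
    refine ⟨?_, ?_, ?_, fun b hb => ?_⟩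
    · rw [Memory.set_of_ne _ (by omega), Memory.set_self]; simp
    · rw [Memory.set_of_ne _ (by omega), Memory.set_of_ne _ (by omega), v1]
    · rw [Memory.set_self]
    · rw [Memory.set_of_ne _ (by omega), Memory.set_of_ne _ (by omega), s1 b (by omega)]
  obtain ⟨m2, t2, e2, ⟨v2, -, -, s2⟩, l2⟩ := Exec.exists_loop
    (e := .sub (.scalar (d + 1)) (.scalar (d + 2)))
    (body := .seq p' (.seq (.set d (.add (.scalar d) (.scalar (d + 3))))
        (.set (d + 2) (.add (.scalar (d + 2)) (.const 1))))) Inv (b a) (T'' a + 2)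
    (by
      rintro i hi m2 ⟨h1, h2, h3, h4⟩
      refine ⟨by simp only [Expr.eval]; rw [h2, h3]; omega, ?_⟩
      obtain ⟨m3, t3, e3, v3, s3, l3⟩ := H' (a, i) m2
        ((ha.congr hρ fun b _ hb => h4 b hb).push h3)
      refine ⟨_, _, e3.seq ((Exec.set _ _ _).seq (Exec.set _ _ _)), ⟨?_, ?_, ?_, ?_⟩, ?_⟩
      · rw [Memory.set_of_ne _ (by omega), Memory.set_self]
        simp only [Expr.eval]
        rw [v3, s3 _ (by omega), h1, Finset.sum_range_succ]
      · rw [Memory.set_of_ne _ (by omega), Memory.set_of_ne _ (by omega), s3 _ (by omega), h2]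
      · rw [Memory.set_self]
        simp only [Expr.eval]
        rw [Memory.set_of_ne _ (by omega), s3 _ (by omega), h3]
      · intro b hb
        rw [Memory.set_of_ne _ (by omega), Memory.set_of_ne _ (by omega), s3 _ (by omega),
          h4 b hb]
      · have := hTT a i hi.le
        omega)
    (by
      rintro m2 ⟨h1, h2, h3, h4⟩
      simp only [Expr.eval]; rw [h2, h3]; omega) hInv0
  exact ⟨m2, _, e1.seq ((Exec.set _ _ _).seq ((Exec.set _ _ _).seq e2)), v2, s2, by omega⟩

theorem mul {f g : α → ℕ} (hf : PolyTime f) (hg : PolyTime g) :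
    PolyTime (fun a => f a * g a) := by
  simpa using hf.sum (f := fun a _ => g a) hg.fst

theorem pow {f : α → ℕ} (hf : PolyTime f) (c : ℕ) : PolyTime (fun a => f a ^ c) := by
  induction c with
  | zero => simpa using const 1
  | succ c ih => simpa only [pow_succ] using ih.mul hf

end PolyTime

open scoped Classical in
/-- The predicates that are decidable in polynomial time. -/
def PolyDec (P : α → Prop) : Prop := PolyTime fun a => if P a then 1 else 0

/-! ### Closure properties of polynomial-time predicates -/

namespace PolyDec

theorem congr {P Q : α → Prop} (hP : PolyDec P) (h : ∀ a, Q a ↔ P a) : PolyDec Q := by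
  rwa [show Q = P from funext fun a => propext (h a)]

theorem of_polyTime {P : α → Prop} {f : α → ℕ} (hf : PolyTime f) (h₁ : ∀ a, P a → f a = 1)
    (h₀ : ∀ a, ¬ P a → f a = 0) : PolyDec P :=
  hf.congr fun a => by
    split_ifs with h
    · exact (h₁ a h).symm
    · exact (h₀ a h).symm

theorem polyTime {P : α → Prop} [DecidablePred P] (hP : PolyDec P) :
    PolyTime fun a => if P a then 1 else 0 :=
  PolyTime.congr hP fun a => by congr

theorem le {f g : α → ℕ} (hf : PolyTime f) (hg : PolyTime g) : PolyDec (fun a => f a ≤ g a) :=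
  -- With cut-off subtraction, 1 - (f - g) is the indicator of f ≤ g.
  of_polyTime ((PolyTime.const 1).sub (hf.sub hg)) (fun a h => by omega) (fun a h => by omega)

theorem not {P : α → Prop} (hP : PolyDec P) : PolyDec (fun a => ¬ P a) := by
  classical
  exact of_polyTime ((PolyTime.const 1).sub hP.polyTime) (fun a h => by simp [h])
    (fun a h => by simp [not_not.1 h])

theorem lt {f g : α → ℕ} (hf : PolyTime f) (hg : PolyTime g) : PolyDec (fun a => f a < g a) :=
  (le hg hf).not.congr fun _ => not_le.symm

theorem bex {b : α → ℕ} {P : α → ℕ → Prop} (hb : PolyTime b)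
    (hP : PolyDec fun q : α × ℕ => P q.1 q.2) : PolyDec (fun a => ∃ i < b a, P a i) := by
  classical
  -- If s is the number of witnesses, 1 - (1 - s) truncates it to 0 or 1.
  refine of_polyTime ((PolyTime.const 1).sub ((PolyTime.const 1).sub
    (hb.sum (f := fun a i => if P a i then 1 else 0) hP.polyTime))) (fun a h => ?_) (fun a h => ?_)
  · obtain ⟨i, hi, hPi⟩ := h
    have := Finset.single_le_sum (f := fun i => if P a i then 1 else 0)
      (fun _ _ => Nat.zero_le _) (Finset.mem_range.2 hi)
    simp only [hPi, if_true] at this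
    omega
  · rw [Finset.sum_eq_zero fun i hi => if_neg fun hPi => h ⟨i, Finset.mem_range.1 hi, hPi⟩]
    rfl

theorem ball {b : α → ℕ} {P : α → ℕ → Prop} (hb : PolyTime b)
    (hP : PolyDec fun q : α × ℕ => P q.1 q.2) : PolyDec (fun a => ∀ i < b a, P a i) :=
  (bex (P := fun a i => ¬ P a i) hb hP.not).not.congr fun a => by push Not; rfl

theorem or {P Q : α → Prop} (hP : PolyDec P) (hQ : PolyDec Q) : PolyDec (fun a => P a ∨ Q a) := by
  classical
  exact of_polyTime
    ((PolyTime.const 1).sub ((PolyTime.const 1).sub (hP.polyTime.add hQ.polyTime)))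
    (fun a h => by split_ifs <;> first | rfl | tauto) (fun a h => by simp [not_or.1 h])

theorem and {P Q : α → Prop} (hP : PolyDec P) (hQ : PolyDec Q) :
    PolyDec (fun a => P a ∧ Q a) :=
  (hP.not.or hQ.not).not.congr fun a => by tauto

theorem imp {P Q : α → Prop} (hP : PolyDec P) (hQ : PolyDec Q) :
    PolyDec (fun a => P a → Q a) :=
  (hP.not.or hQ).congr fun a => by tauto

theorem eq {f g : α → ℕ} (hf : PolyTime f) (hg : PolyTime g) : PolyDec (fun a => f a = g a) :=
  ((le hf hg).and (le hg hf)).congr fun _ => le_antisymm_iff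

theorem const (P : Prop) : PolyDec (fun _ : α => P) := PolyTime.const _

/-- The quantifier is unrolled, so the program may depend on i. This serves digit positions, which
occur as exponents, while `PolyTime.pow` allows constant exponents only. -/
theorem bex_const {P : ℕ → α → Prop} (N : ℕ) (hP : ∀ i < N, PolyDec (P i)) :
    PolyDec (fun a => ∃ i < N, P i a) := by
  induction N with
  | zero => exact (const False).congr fun a => by simp
  | succ N ih =>
    refine ((ih fun i hi => hP i (by omega)).or (hP N (by omega))).congr fun a => ?_
    exact Nat.exists_lt_succ_right

theorem ball_const {P : ℕ → α → Prop} (N : ℕ) (hP : ∀ i < N, PolyDec (P i)) :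
    PolyDec (fun a => ∀ i < N, P i a) :=
  (bex_const N fun i hi => (hP i hi).not).not.congr fun a => by push Not; rfl

end PolyDec

namespace PolyTime

/-- The quotient counts the i < f with (i + 1) g ≤ f; the condition 0 < g makes the count 0 for a
zero divisor. -/
theorem div {f g : α → ℕ} (hf : PolyTime f) (hg : PolyTime g) :
    PolyTime (fun a => f a / g a) := by
  classical
  have h : PolyDec fun q : α × ℕ => 0 < g q.1 ∧ (q.2 + 1) * g q.1 ≤ f q.1 :=
    (PolyDec.lt (const 0) hg.fst).and
      (PolyDec.le ((snd.add (const 1)).mul hg.fst) hf.fst)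
  refine (hf.sum (f := fun a i => if 0 < g a ∧ (i + 1) * g a ≤ f a then 1 else 0)
    h.polyTime).congr fun a => ?_
  rcases Nat.eq_zero_or_pos (g a) with h0 | h0
  · simp [h0]
  · rw [Finset.sum_boole, Nat.cast_id]
    have : {i ∈ Finset.range (f a) | 0 < g a ∧ (i + 1) * g a ≤ f a} =
        Finset.range (f a / g a) := by
      ext i
      simp only [Finset.mem_filter, Finset.mem_range, h0, true_and, ← Nat.le_div_iff_mul_le h0]
      have := Nat.div_le_self (f a) (g a)
      omega
    rw [this, Finset.card_range]

theorem mod {f g : α → ℕ} (hf : PolyTime f) (hg : PolyTime g) :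
    PolyTime (fun a => f a % g a) :=
  (hf.sub (hg.mul (hf.div hg))).congr fun _ => Nat.mod_eq_sub_mul_div

end PolyTime

/-- Array `2` holds the word `u` and cell `0` of array `3` its length. -/
def Written (m : Memory) (u : List Bool) : Prop :=
  m 3 0 = u.length ∧ ∀ i < u.length, m 2 i = cellCode u i

/-- The words that can be appended to the output in polynomial time. -/
def PolyWritable (w : α → List Bool) : Prop :=
  ∀ (ρ : ℕ → ℕ) (d : ℕ), (∀ j < depth α, ρ j < d) →
    ∃ (p : Program) (T : α → ℕ), PolyBounded T ∧ ∀ a m u, Holds ρ m a → Written m u →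
      ∃ m' t, Exec p m m' t ∧ Written m' (u ++ w a) ∧
        (∀ b, 4 ≤ b → b < 7 + d → m' b = m b) ∧ t ≤ T a

/-! ### Writing words to the output -/

namespace PolyWritable

open scoped Classical in
theorem bit {P : α → Prop} (hP : PolyDec P) : PolyWritable (fun a => [decide (P a)]) := by
  intro ρ d hρ
  obtain ⟨p, T, hT, H⟩ := hP.2 ρ d hρ
  refine ⟨.seq p (.seq (.assign 2 (.read 3 (.const 0)) (.add (.scalar d) (.const 1)))
    (.assign 3 (.const 0) (.add (.read 3 (.const 0)) (.const 1)))), _, hT.add (.const 2),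
    fun a m u ha hu => ?_⟩
  obtain ⟨m1, t1, e1, v1, s1, l1⟩ := H a m ha
  refine ⟨_, _, e1.seq ((Exec.assign _ _ _ _).seq (Exec.assign _ _ _ _)), ⟨?_, ?_⟩, ?_, by omega⟩
  · simp [Expr.eval, s1 3 (by omega), hu.1]
  · intro i hi
    simp only [Expr.eval, s1 3 (by omega), hu.1, s1 2 (by omega), v1]
    rw [Function.update_of_ne (by omega), Function.update_self]
    by_cases hiu : i < u.length
    · rw [Function.update_of_ne hiu.ne, cellCode_append_left hiu, hu.2 i hiu]
    · obtain rfl : i = u.length := by simp at hi; omega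
      rw [Function.update_self, cellCode_append_right le_rfl]
      by_cases h : P a <;> simp [h, cellCode]
  · intro b hb hb'
    rw [Function.update_of_ne (by omega), Function.update_of_ne (by omega), s1 b hb']

theorem append {w w' : α → List Bool} (hw : PolyWritable w) (hw' : PolyWritable w') :
    PolyWritable (fun a => w a ++ w' a) := by
  intro ρ d hρ
  obtain ⟨p, T, hT, H⟩ := hw ρ d hρ
  obtain ⟨p', T', hT', H'⟩ := hw' ρ d hρ
  refine ⟨.seq p p', _, hT.add hT', fun a m u ha hu => ?_⟩
  obtain ⟨m1, t1, e1, v1, s1, l1⟩ := H a m u ha hu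
  obtain ⟨m2, t2, e2, v2, s2, l2⟩ := H' a m1 _ (ha.congr hρ s1) v1
  exact ⟨m2, _, e1.seq e2, by rwa [← List.append_assoc],
    fun b hb hb' => by rw [s2 b hb hb', s1 b hb hb'], by omega⟩

theorem flatMap {b : α → ℕ} {w : α → ℕ → List Bool} (hb : PolyTime b)
    (hw : PolyWritable fun q : α × ℕ => w q.1 q.2) :
    PolyWritable (fun a => (List.range (b a)).flatMap (w a)) := by
  intro ρ d hρ
  obtain ⟨p, T, hT, H⟩ := hb.2 ρ d hρ
  obtain ⟨p', T', hT', H'⟩ := hw (Function.update ρ (depth α) (d + 1)) (d + 2)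
    (update_lt (fun j hj => (hρ j hj).trans (by omega)) (by omega))
  obtain ⟨T'', hT'', hTT⟩ := hT'.subst hb.1
  refine ⟨.seq p (.seq (.set (d + 1) (.const 0)) (.loop (.sub (.scalar d) (.scalar (d + 1)))
      (.seq p' (.set (d + 1) (.add (.scalar (d + 1)) (.const 1)))))), _,
    (hT.add (.const 1)).add ((hb.1.mul ((hT''.add (.const 1)).add (.const 1))).add (.const 1)),
    fun a m u ha hu => ?_⟩
  obtain ⟨m1, t1, e1, v1, s1, l1⟩ := H a m ha
  let Inv : ℕ → Memory → Prop := fun i m' =>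
    Written m' (u ++ (List.range i).flatMap (w a)) ∧ m' (7 + d) 0 = b a ∧
      m' (7 + (d + 1)) 0 = i ∧ ∀ b, 4 ≤ b → b < 7 + d → m' b = m b
  have hInv0 : Inv 0 (m1.set (d + 1) 0) := by
    refine ⟨?_, ?_, ?_, fun b _ hb => ?_⟩
    · rw [Written, Memory.set_of_ne _ (by omega), Memory.set_of_ne _ (by omega), s1 3 (by omega),
        s1 2 (by omega)]
      simpa [Written] using hu
    · rw [Memory.set_of_ne _ (by omega), v1]
    · rw [Memory.set_self]
    · rw [Memory.set_of_ne _ (by omega), s1 b (by omega)]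
  obtain ⟨m2, t2, e2, ⟨v2, -, -, s2⟩, l2⟩ := Exec.exists_loop
    (e := .sub (.scalar d) (.scalar (d + 1)))
    (body := .seq p' (.set (d + 1) (.add (.scalar (d + 1)) (.const 1)))) Inv (b a) (T'' a + 1)
    (by
      rintro i hi m2 ⟨h1, h2, h3, h4⟩
      refine ⟨by simp only [Expr.eval]; rw [h2, h3]; omega, ?_⟩
      obtain ⟨m3, t3, e3, v3, s3, l3⟩ := H' (a, i) m2 _ ((ha.congr hρ h4).push h3) h1
      refine ⟨_, _, e3.seq (Exec.set _ _ _), ⟨?_, ?_, ?_, ?_⟩, ?_⟩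
      · rw [Written, Memory.set_of_ne _ (by omega), Memory.set_of_ne _ (by omega)]
        simpa [List.range_succ, Written] using v3
      · rw [Memory.set_of_ne _ (by omega), s3 _ (by omega) (by omega), h2]
      · rw [Memory.set_self]
        simp only [Expr.eval]
        rw [s3 _ (by omega) (by omega), h3]
      · intro b hb hb'
        rw [Memory.set_of_ne _ (by omega), s3 _ hb (by omega), h4 b hb hb']
      · have := hTT a i hi.le
        omega)
    (by
      rintro m2 ⟨h1, h2, h3, h4⟩
      simp only [Expr.eval]; rw [h2, h3]; omega) hInv0
  exact ⟨m2, _, e1.seq ((Exec.set _ _ _).seq e2), v2, s2, by omega⟩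

end PolyWritable

end Framework

/-! ### Composition of reductions -/

theorem computable_add_const_pow {f g : ℕ → ℕ} (hf : Computable f) (hg : Computable g)
    (a c : ℕ) : Computable fun k => (f k + g k + a) ^ c := by
  have h1 : Primrec₂ fun x y : ℕ => (x + y + a) ^ c := by
    have hs : Primrec₂ fun x y : ℕ => x + y + a :=
      Primrec.nat_add.comp₂ Primrec.nat_add (Primrec.const a).to₂
    have hp : ∀ c : ℕ, Primrec fun n : ℕ => n ^ c := fun c => by
      induction c with
      | zero => simpa using Primrec.const 1
      | succ c ih =>
        simp only [pow_succ]
        exact Primrec.nat_mul.comp ih Primrec.id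
    exact (hp c).comp₂ hs
  exact h1.to_comp.comp hf hg

/-- A polynomial-time map can be computed from the output of another program. -/
theorem exists_program_of_polyWritable {w : Inst → List Bool} {l : Inst → ℕ}
    (hw : PolyWritable w) (hl : PolyTime l) :
    ∃ (p : Program) (c : ℕ), ∀ (m : Memory) (y : Inst), HoldsOutput m y.word y.param →
      ∃ m' t, Exec p m m' t ∧ HoldsOutput m' (w y) (l y) ∧
        t ≤ (y.word.length + y.param + 2) ^ c := by
  obtain ⟨p, T, hT, H⟩ := hw id 0 fun j hj => absurd hj (Nat.not_lt_zero j)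
  obtain ⟨p', T', hT', H'⟩ := hl.2 id 0 fun j hj => absurd hj (Nat.not_lt_zero j)
  obtain ⟨c, hc⟩ : PolyBounded fun y : Inst =>
      y.word.length * (2 + 1) + 1 + T y + T' y + 5 :=
    ((((PolyTime.length.1.mul (.const _)).add (.const 1)).add hT).add hT').add (.const 5)
  -- Array `2` is copied to array `4` while its length is counted in array `5`, and the parameter
  -- moves to array `6`. Then `p` overwrites array `2`, with array `3` as length counter, and `p'`
  -- leaves the new parameter in array `7`. Remains of the old word may follow the new one, hence
  -- the final 0.
  refine ⟨.seq (.assign 5 (.const 0) (.const 0)) (.seq (.loop (.read 2 (.read 5 (.const 0)))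
    (.seq (.assign 4 (.read 5 (.const 0)) (.read 2 (.read 5 (.const 0))))
      (.assign 5 (.const 0) (.add (.read 5 (.const 0)) (.const 1)))))
    (.seq (.assign 6 (.const 0) (.read 3 (.const 0))) (.seq (.assign 3 (.const 0) (.const 0))
    (.seq p (.seq p' (.seq (.assign 2 (.read 3 (.const 0)) (.const 0))
      (.assign 3 (.const 0) (.read 7 (.const 0))))))))), c, fun m y hy => ?_⟩
  obtain ⟨hy2, hy3⟩ := hy
  let Inv : ℕ → Memory → Prop := fun i m' =>
    m' 5 0 = i ∧ (∀ j < i, m' 4 j = cellCode y.word j) ∧ m' 2 = m 2 ∧ m' 3 = m 3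
  obtain ⟨m1, t1, e1, ⟨v5, v4, v2, v3⟩, l1⟩ := Exec.exists_loop
    (e := .read 2 (.read 5 (.const 0)))
    (body := .seq (.assign 4 (.read 5 (.const 0)) (.read 2 (.read 5 (.const 0))))
      (.assign 5 (.const 0) (.add (.read 5 (.const 0)) (.const 1)))) Inv y.word.length 2
    (by
      rintro i hi m1 ⟨h1, h2, h3, h4⟩
      refine ⟨?_, _, _, (Exec.assign _ _ _ _).seq (Exec.assign _ _ _ _),
        ⟨?_, ?_, ?_, ?_⟩, le_rfl⟩
      · simp only [Expr.eval, h1, h3, hy2 i hi.le]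
        exact cellCode_ne_zero_iff.2 hi
      · simp [Expr.eval, h1]
      · intro j hj
        simp only [Expr.eval, h1, h3, hy2 i hi.le]
        rw [Function.update_of_ne (by omega), Function.update_self]
        by_cases hji : j = i
        · rw [hji, Function.update_self]
        · rw [Function.update_of_ne hji, h2 j (by omega)]
      · simpa using h3
      · simpa using h4)
    (by
      rintro m1 ⟨h1, h2, h3, h4⟩
      simp only [Expr.eval, h1, h3, hy2 _ le_rfl]
      by_contra h
      exact lt_irrefl _ (cellCode_ne_zero_iff.1 h))
    (m := Function.update m 5 (Function.update (m 5) 0 0))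
    ⟨by simp, fun j hj => absurd hj (Nat.not_lt_zero j), by simp, by simp⟩
  let m2 := Function.update m1 6 (Function.update (m1 6) 0 (m1 3 0))
  let m3 := Function.update m2 3 (Function.update (m2 3) 0 0)
  have hm3 : Holds id m3 y := by
    refine ⟨?_, ?_, ?_, fun j hj => absurd hj (Nat.not_lt_zero j)⟩
    · change ∀ i < y.word.length, m3 4 i = cellCode y.word i
      simpa [m3, m2] using v4
    · change m3 5 0 = y.word.length
      simpa [m3, m2] using v5
    · simp [m3, m2, v3, hy3]; rfl
  have hw3 : Written m3 [] := ⟨by simp [m3], fun i hi => absurd hi (Nat.not_lt_zero i)⟩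
  obtain ⟨m4, t4, e4, v4, s4, l4⟩ := H y m3 [] hm3 hw3
  obtain ⟨m5, t5, e5, v5, s5, l5⟩ := H' y m4
    (hm3.congr (fun j hj => absurd hj (Nat.not_lt_zero j)) s4)
  refine ⟨_, _, (Exec.assign _ _ _ _).seq (e1.seq ((Exec.assign _ _ _ _).seq
    ((Exec.assign _ _ _ _).seq (e4.seq (e5.seq ((Exec.assign _ _ _ _).seq
      (Exec.assign _ _ _ _))))))), ⟨?_, ?_⟩, ?_⟩
  · intro i hi
    rw [Function.update_of_ne (by omega), Function.update_self]
    simp only [Expr.eval, s5 3 (by omega), s5 2 (by omega)]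
    obtain ⟨w3, w2⟩ := v4
    simp only [List.nil_append] at w3 w2
    rw [w3]
    rcases hi.lt_or_eq with h | h
    · rw [Function.update_of_ne h.ne, w2 i h]
    · rw [h, Function.update_self]
      by_contra h'
      exact lt_irrefl _ (cellCode_ne_zero_iff.1 (Ne.symm h'))
  · simpa [Expr.eval] using v5
  · refine le_trans ?_ (hc y)
    dsimp only
    omega

/-- The intermediate word is no longer than the running time that produced it, and its parameter is
at most `g k`, so a polynomial in its size is again an admissible time bound. -/
theorem FPTReducible.trans_polyTime {P Q R : ParamProblem} (hPQ : FPTReducible P Q)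
    {w : Inst → List Bool} {l : Inst → ℕ} (hw : PolyWritable w) (hl : PolyTime l) (e : ℕ)
    (hle : ∀ y : Inst, l y ≤ (y.param + 2) ^ e)
    (hQR : ∀ y : Inst, (y.word, y.param) ∈ Q ↔ (w y, l y) ∈ R) : FPTReducible P R := by
  obtain ⟨r, p, f, g, c, hf, hg, hr, hrg, hp⟩ := hPQ
  obtain ⟨p', c', hp'⟩ := exists_program_of_polyWritable hw hl
  let s : List Bool × ℕ → Inst := fun q => ⟨(r q).1, (r q).2⟩
  refine ⟨fun q => (w (s q), l (s q)), .seq p p', fun k => (f k + g k + 2) ^ (c' + 2),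
    fun k => (g k + 0 + 2) ^ e, c * (c' + 2), computable_add_const_pow hf hg _ _,
    computable_add_const_pow hg (.const 0) _ _, fun x k => ?_, fun x k => ?_, fun x k => ?_⟩
  · rw [hr]; exact hQR (s (x, k))
  · exact (hle _).trans (Nat.pow_le_pow_left (by have := hrg x k; simp only [s]; omega) _)
  · obtain ⟨m, t, h1, h2, h3⟩ := hp x k
    obtain ⟨m', t', h1', h2', h3'⟩ := hp' m (s (x, k)) h2
    refine ⟨m', t + t', h1.seq h1', h2', ?_⟩
    -- Array `2` is zero at the start and letters have nonzero codes, so every cell of the output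
    -- word has been written to.
    have hlen : (r (x, k)).1.length ≤ t := by
      obtain ⟨S, hS, hS'⟩ := h1.exists_support 2
      have hsub : Finset.range (r (x, k)).1.length ⊆ S := fun i hi => by
        by_contra hiS
        have hi' := Finset.mem_range.1 hi
        have := hS' i hiS
        rw [h2.1 i hi'.le] at this
        exact cellCode_ne_zero_iff.2 hi' (by simpa [initMemory] using this)
      simpa using (Finset.card_le_card hsub).trans hS
    have hpos : 1 ≤ (x.length + 1) ^ c := Nat.one_le_pow _ _ (by omega)
    set X := (x.length + 1) ^ c
    -- `Z` dominates the size of the intermediate instance, and its powers are still a function of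
    -- `k` times a power of the input length plus one.
    set Z := (f k + g k + 2) * X
    have hZX : Z = f k * X + g k * X + 2 * X := by simp only [Z]; ring
    have hgX : g k ≤ g k * X := Nat.le_mul_of_pos_right _ hpos
    have hZ2 : 2 ≤ Z := by omega
    have hZ : t + g k + 2 ≤ Z := by omega
    have ht' : t' ≤ Z ^ c' := h3'.trans (Nat.pow_le_pow_left (by
      have := hrg x k
      simp only [s]
      omega) _)
    have hone : 1 ≤ Z ^ c' := Nat.one_le_pow _ _ (by omega)
    calc t + t' ≤ Z ^ (c' + 2) := by
          have : t ≤ Z * Z ^ c' := by nlinarith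
          have : Z ^ c' ≤ Z * Z ^ c' := by nlinarith
          rw [pow_add, pow_two]
          nlinarith
      _ = _ := by rw [mul_pow, ← pow_mul]

/-! ## Circuits of bounded depth and weft -/

namespace Circuit

variable (C : Circuit)

/-- Every path that ends in the node has at most `d` gates, at most `w` of them large. -/
def Bounded : ℕ → ℕ → Fin (C.last + 1) → Prop
  | 0, _, j => C.kind j = .input
  | d + 1, w, j => C.kind j = .input ∨ (C.IsLarge j → 0 < w) ∧ ∀ i, C.wire i j →
      (C.IsLarge j → Bounded d (w - 1) i) ∧ (¬ C.IsLarge j → Bounded d w i)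

variable {C}

theorem not_isLarge_of_input {j : Fin (C.last + 1)} (h : C.kind j = .input) : ¬ C.IsLarge j := by
  have : {i | C.wire i j} = ∅ := Set.eq_empty_of_forall_notMem fun i => C.no_wire_to_input i j h
  simp [IsLarge, this]

-- Splitting off the last node of a path turns the quantifier over paths into a recursion, which
-- supports induction on the depth and a polynomial-time test.
open scoped Classical in
theorem bounded_iff {d w : ℕ} {j : Fin (C.last + 1)} :
    C.Bounded d w j ↔ ∀ p : List (Fin (C.last + 1)), p.IsChain C.wire → p.getLast? = some j →
      p.countP (fun j => decide (C.kind j ≠ .input)) ≤ d ∧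
        p.countP (fun j => decide (C.IsLarge j)) ≤ w := by
  -- No wire enters an input, so the only path that ends there is the trivial one.
  have input : ∀ {d w j}, C.kind j = .input → ∀ p : List (Fin (C.last + 1)),
      p.IsChain C.wire → p.getLast? = some j →
      p.countP (fun j => decide (C.kind j ≠ .input)) ≤ d ∧
        p.countP (fun j => decide (C.IsLarge j)) ≤ w := by
    intro d w j hj p hp hpj
    obtain ⟨p, rfl⟩ := List.getLast?_eq_some_iff.1 hpj
    rw [List.isChain_append] at hp
    have hnil : p = [] := by
      rw [← List.getLast?_eq_none_iff]
      by_contra h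
      obtain ⟨i, hi⟩ := Option.ne_none_iff_exists'.1 h
      exact C.no_wire_to_input i j hj (hp.2.2 i hi j (by simp))
    subst hnil
    simp [hj, not_isLarge_of_input hj]
  induction d generalizing w j with
  | zero =>
    refine ⟨fun h => input h, fun h => ?_⟩
    have := (h [j] (by simp) (by simp)).1
    by_contra hj
    have hj' : C.kind j ≠ .input := hj
    simp [hj'] at this
  | succ d ih =>
    refine ⟨?_, fun h => ?_⟩
    · rintro (h | ⟨h0, h⟩)
      · exact input h
      intro p hp hpj
      obtain ⟨p, rfl⟩ := List.getLast?_eq_some_iff.1 hpj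
      rw [List.isChain_append] at hp
      have hgate : [j].countP (fun j => decide (C.kind j ≠ .input)) ≤ 1 :=
        List.countP_le_length
      rw [List.countP_append, List.countP_append]
      rcases hl : p.getLast? with _ | i
      · rw [List.getLast?_eq_none_iff] at hl
        subst hl
        refine ⟨by simp only [List.countP_nil]; omega, ?_⟩
        by_cases hL : C.IsLarge j
        · simpa [hL, Nat.one_le_iff_ne_zero, Nat.pos_iff_ne_zero] using h0 hL
        · simp [hL]
      · obtain ⟨hL, hS⟩ := h i (hp.2.2 i hl j (by simp))
        by_cases hj : C.IsLarge j
        · obtain ⟨h1, h2⟩ := ih.1 (hL hj) p hp.1 hl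
          refine ⟨by omega, ?_⟩
          have := h0 hj
          simp only [List.countP_singleton, hj, decide_true, if_true]
          omega
        · obtain ⟨h1, h2⟩ := ih.1 (hS hj) p hp.1 hl
          refine ⟨by omega, ?_⟩
          simpa [List.countP_singleton, hj] using h2
    · by_cases hj : C.kind j = .input
      · exact Or.inl hj
      refine Or.inr ⟨fun hL => ?_, fun i hi => ?_⟩
      · simpa [hL, Nat.one_le_iff_ne_zero, Nat.pos_iff_ne_zero] using (h [j] (by simp) (by simp)).2
      -- Prolonging a path by the gate `j` costs one unit of depth and, if `j` is large, one unit of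
      -- weft.
      have key : ∀ p : List (Fin (C.last + 1)), p.IsChain C.wire → p.getLast? = some i →
          p.countP (fun j => decide (C.kind j ≠ .input)) ≤ d ∧
            p.countP (fun j => decide (C.IsLarge j)) + (if C.IsLarge j then 1 else 0) ≤ w := by
        intro p hp hpi
        have := h (p ++ [j]) (by
          rw [List.isChain_append]
          refine ⟨hp, by simp, fun x hx y hy => ?_⟩
          obtain rfl : i = x := by simpa [hpi] using hx
          obtain rfl : j = y := by simpa using hy
          exact hi) (by simp)
        simpa [List.countP_append, List.countP_singleton, hj] using this
      refine ⟨fun hL => ih.2 fun p hp hpi => ?_, fun hL => ih.2 fun p hp hpi => ?_⟩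
      · have := key p hp hpi
        rw [if_pos hL] at this
        omega
      · have := key p hp hpi
        rwa [if_neg hL] at this

theorem bounded_last_iff {h w : ℕ} :
    C.Bounded h w (Fin.last C.last) ↔ C.WeftLE w ∧ C.DepthLE h := by
  rw [bounded_iff]
  exact ⟨fun H => ⟨fun p hp => (H p hp.1 hp.2).2, fun p hp => (H p hp.1 hp.2).1⟩,
    fun H p h1 h2 => ⟨H.2 p ⟨h1, h2⟩, H.1 p ⟨h1, h2⟩⟩⟩

variable (C) in
/-- `C.Ev W base d b j`: by a proof of depth at most `d`, node `j` has value `b`, where `base b x`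
says that input `x` may have value `b`. One child suffices for a disjunction to be true and for a
conjunction to be false; at large gates this child has to be in `W`. -/
def Ev (W : Fin (C.last + 1) → Prop) (base : Bool → Fin (C.last + 1) → Prop) :
    ℕ → Bool → Fin (C.last + 1) → Prop
  | 0, b, j => C.kind j = .input ∧ base b j
  | d + 1, b, j => (C.kind j = .input ∧ base b j) ∨
      (C.kind j = .notGate ∧ ∃ i, C.wire i j ∧ Ev W base d (!b) i) ∨
      (C.kind j = (if b then .andGate else .orGate) ∧ ∀ i, C.wire i j → Ev W base d b i) ∨
      (C.kind j = (if b then .orGate else .andGate) ∧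
        ∃ i, C.wire i j ∧ (C.IsLarge j → W i) ∧ Ev W base d b i)

/-! ### Proofs of node values: soundness, size, and locality of failure -/

section Ev

variable {W W' : Fin (C.last + 1) → Prop} {base base' : Bool → Fin (C.last + 1) → Prop}
  {d : ℕ} {b : Bool} {j : Fin (C.last + 1)}

theorem Ev.mono (hW : ∀ i, W i → W' i)
    (hbase : ∀ b x, C.kind x = .input → base b x → base' b x) (h : C.Ev W base d b j) :
    C.Ev W' base' d b j := by
  induction d generalizing b j with
  | zero => exact ⟨h.1, hbase _ _ h.1 h.2⟩
  | succ d ih =>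
    rcases h with ⟨h1, h2⟩ | ⟨h1, i, h2, h3⟩ | ⟨h1, h2⟩ | ⟨h1, i, h2, h3, h4⟩
    · exact Or.inl ⟨h1, hbase _ _ h1 h2⟩
    · exact Or.inr (Or.inl ⟨h1, i, h2, ih h3⟩)
    · exact Or.inr (Or.inr (Or.inl ⟨h1, fun i hi => ih (h2 i hi)⟩))
    · exact Or.inr (Or.inr (Or.inr ⟨h1, i, h2, fun hL => hW i (h3 hL), ih h4⟩))

theorem ev_input (hj : C.kind j = .input) : C.Ev W base d b j ↔ base b j := by
  cases d with
  | zero => simp [Ev, hj]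
  | succ d => cases b <;> simp [Ev, hj]

/-- `W` only restricts which proofs are allowed and plays no role for soundness. -/
theorem Ev.sound {v : Fin (C.last + 1) → Prop} (hv : C.IsValuation v)
    (hbase : ∀ b x, C.kind x = .input → base b x → (v x ↔ b = true)) (h : C.Ev W base d b j) :
    v j ↔ b = true := by
  induction d generalizing b j with
  | zero => exact hbase _ _ h.1 h.2
  | succ d ih =>
    have hvj := hv j
    rcases h with ⟨h1, h2⟩ | ⟨h1, i, h2, h3⟩ | ⟨h1, h2⟩ | ⟨h1, i, h2, h3, h4⟩
    · exact hbase _ _ h1 h2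
    · simp only [h1] at hvj
      obtain ⟨i', -, hu⟩ := C.existsUnique_of_not j h1
      have hi := ih h3
      rw [hvj]
      constructor
      · rintro ⟨i'', h4, h5⟩
        rw [hu i'' h4, ← hu i h2, hi] at h5
        simpa using h5
      · intro hb
        exact ⟨i, h2, by simp [hi, hb]⟩
    · cases b
      · obtain ⟨i, hi⟩ := C.exists_of_or j (by simpa using h1)
        simp only [Bool.false_eq_true, if_false] at h1
        simp only [h1] at hvj
        rw [hvj]
        simp only [Bool.false_eq_true, iff_false, not_exists, not_and]
        exact fun i hi => by simpa using ih (h2 i hi)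
      · simp only [if_true] at h1
        simp only [h1] at hvj
        rw [hvj]
        simp only [iff_true]
        exact fun i hi => by simpa using ih (h2 i hi)
    · cases b
      · simp only [Bool.false_eq_true, if_false] at h1
        simp only [h1] at hvj
        rw [hvj]
        simp only [Bool.false_eq_true, iff_false, not_forall]
        exact ⟨i, h2, by simpa using ih h4⟩
      · simp only [if_true] at h1
        simp only [h1] at hvj
        rw [hvj]
        simp only [iff_true]
        exact ⟨i, h2, by simpa using ih h4⟩

open scoped Classical in
/-- A union over the children of a node, for proofs with a `W` of bounded size. -/
theorem exists_of_forall_children {w : ℕ}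
    (h : ∀ i, C.wire i j → ∃ W : Finset (Fin (C.last + 1)), W.card ≤ 2 ^ d ∧
      ((w = 0 ∨ C.IsLarge j) → W = ∅) ∧ C.Ev (· ∈ W) base d b i) :
    ∃ W : Finset (Fin (C.last + 1)), W.card ≤ 2 ^ (d + 1) ∧ (w = 0 → W = ∅) ∧
      ∀ i, C.wire i j → C.Ev (· ∈ W) base d b i := by
  choose! f hf using h
  -- The children of a large gate come with empty sets; a small gate has at most two children, which
  -- doubles the bound.
  by_cases hL : C.IsLarge j
  · refine ⟨∅, by simp, by simp, fun i hi => ?_⟩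
    have := (hf i hi).2.2
    rwa [(hf i hi).2.1 (Or.inr hL)] at this
  · refine ⟨{i | C.wire i j}.toFinset.biUnion f, ?_, fun h0 => ?_, fun i hi => ?_⟩
    · refine (Finset.card_biUnion_le_card_mul _ _ (2 ^ d) fun i hi => ?_).trans ?_
      · exact (hf i (by simpa using hi)).1
      · rw [← Set.ncard_eq_toFinset_card', pow_succ, mul_comm]
        exact Nat.mul_le_mul_left _ (not_lt.1 hL)
    · refine Finset.eq_empty_of_forall_notMem fun x hx => ?_
      obtain ⟨i, hi, hx⟩ := Finset.mem_biUnion.1 hx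
      rw [(hf i (by simpa using hi)).2.1 (Or.inl h0)] at hx
      simp at hx
    · exact (hf i hi).2.2.mono
        (fun x hx => Finset.mem_biUnion.2 ⟨i, by simpa using hi, hx⟩) fun _ _ _ h => h

/-- With weft at most one, no large gate lies below another. A proof therefore branches at most in
two until it meets a large gate, where at most one child has to be recorded; below that nothing is
recorded. This gives 2^d. -/
theorem exists_ev {v : Fin (C.last + 1) → Prop} (hv : C.IsValuation v)
    (hbase : ∀ b x, C.kind x = .input → (v x ↔ b = true) → base b x) {w : ℕ} (hw : w ≤ 1)
    (hd : C.Bounded d w j) (hb : v j ↔ b = true) :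
    ∃ W : Finset (Fin (C.last + 1)), W.card ≤ 2 ^ d ∧ (w = 0 → W = ∅) ∧
      C.Ev (· ∈ W) base d b j := by
  induction d generalizing b j w with
  | zero => exact ⟨∅, by simp, by simp, hd, hbase _ _ hd hb⟩
  | succ d ih =>
    by_cases hj : C.kind j = .input
    · exact ⟨∅, by simp, by simp, (ev_input hj).2 (hbase _ _ hj hb)⟩
    obtain ⟨h0, hd⟩ := hd.resolve_left hj
    have hvj := hv j
    have step : ∀ b i, C.wire i j → (v i ↔ b = true) → ∃ W : Finset (Fin (C.last + 1)),
        W.card ≤ 2 ^ d ∧ ((w = 0 ∨ C.IsLarge j) → W = ∅) ∧ C.Ev (· ∈ W) base d b i := by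
      intro b i hi hvi
      by_cases hL : C.IsLarge j
      · obtain ⟨W, h1, h2, h3⟩ := ih (w := w - 1) (by omega) ((hd i hi).1 hL) hvi
        exact ⟨W, h1, fun _ => h2 (by omega), h3⟩
      · obtain ⟨W, h1, h2, h3⟩ := ih hw ((hd i hi).2 hL) hvi
        exact ⟨W, h1, fun h => h2 (by tauto), h3⟩
    have all : C.kind j = (if b then .andGate else .orGate) →
        (∀ i, C.wire i j → (v i ↔ b = true)) → ∃ W : Finset (Fin (C.last + 1)),
          W.card ≤ 2 ^ (d + 1) ∧ (w = 0 → W = ∅) ∧ C.Ev (· ∈ W) base (d + 1) b j := by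
      intro hk hall
      obtain ⟨W, h1, h2, h3⟩ := exists_of_forall_children fun i hi => step b i hi (hall i hi)
      exact ⟨W, h1, h2, Or.inr (Or.inr (Or.inl ⟨hk, h3⟩))⟩
    have one : C.kind j = (if b then .orGate else .andGate) →
        (∃ i, C.wire i j ∧ (v i ↔ b = true)) → ∃ W : Finset (Fin (C.last + 1)),
          W.card ≤ 2 ^ (d + 1) ∧ (w = 0 → W = ∅) ∧ C.Ev (· ∈ W) base (d + 1) b j := by
      rintro hk ⟨i, hi, hvi⟩
      obtain ⟨W, h1, h2, h3⟩ := step b i hi hvi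
      by_cases hL : C.IsLarge j
      · refine ⟨{i}, by simpa using Nat.one_le_two_pow, fun h => absurd (h0 hL) (by omega), ?_⟩
        rw [h2 (Or.inr hL)] at h3
        exact Or.inr (Or.inr (Or.inr ⟨hk, i, hi, fun _ => by simp,
          h3.mono (by simp) fun _ _ _ h => h⟩))
      · exact ⟨W, h1.trans (Nat.pow_le_pow_right (by omega) (by omega)), fun h => h2 (Or.inl h),
          Or.inr (Or.inr (Or.inr ⟨hk, i, hi, fun h => absurd h hL, h3⟩))⟩
    cases hk : C.kind j with
    | input => exact absurd hk hj
    | notGate =>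
      simp only [hk] at hvj
      obtain ⟨i, hi, hu⟩ := C.existsUnique_of_not j hk
      obtain ⟨W, h1, h2, h3⟩ := step (!b) i hi (by
        have : v j ↔ ¬ v i := hvj.trans
          ⟨fun ⟨i', h1, h2⟩ => hu i' h1 ▸ h2, fun h => ⟨i, hi, h⟩⟩
        rw [this] at hb
        cases b <;> simpa using hb)
      exact ⟨W, h1.trans (Nat.pow_le_pow_right (by omega) (by omega)), fun h => h2 (Or.inl h),
        Or.inr (Or.inl ⟨hk, i, hi, h3⟩)⟩
    | andGate =>
      simp only [hk] at hvj
      rw [hvj] at hb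
      cases b
      · exact one hk (by simpa using hb)
      · exact all hk (by simpa using hb)
    | orGate =>
      simp only [hk] at hvj
      rw [hvj] at hb
      cases b
      · exact all hk (by simpa using hb)
      · exact one hk (by simpa using hb)

/-- If a node cannot be shown to have a value, this is because of few inputs. -/
theorem exists_finset_of_not_ev {R : ℕ} (hR : {i | W i}.ncard ≤ R) (h : ¬ C.Ev W base d b j) :
    ∃ X : Finset (Fin (C.last + 1)), (∀ x ∈ X, C.kind x = .input) ∧ X.card ≤ (R + 2) ^ d ∧
      ∀ base' : Bool → Fin (C.last + 1) → Prop,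
        (∀ x ∈ X, ∀ b, base' b x → base b x) → ¬ C.Ev W base' d b j := by
  classical
  induction d generalizing b j with
  | zero =>
    by_cases hj : C.kind j = .input
    · rw [ev_input hj] at h
      exact ⟨{j}, by simpa using hj, by simp, fun base' hb he =>
        h (hb j (by simp) b ((ev_input hj).1 he))⟩
    · exact ⟨∅, by simp, by simp, fun base' _ he => hj he.1⟩
  | succ d ih =>
    have hpow : (R + 2) ^ d ≤ (R + 2) ^ (d + 1) := Nat.pow_le_pow_right (by omega) (by omega)
    have hand : ∀ {b : Bool}, (if b then NodeKind.andGate else .orGate) ≠ .notGate := by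
      intro b; cases b <;> simp
    have hor : ∀ {b : Bool}, (if b then NodeKind.orGate else .andGate) ≠ .notGate := by
      intro b; cases b <;> simp
    have hao : ∀ {b : Bool}, (if b then NodeKind.andGate else .orGate) ≠
        (if b then .orGate else .andGate) := by
      intro b; cases b <;> simp
    by_cases hj : C.kind j = .input
    · rw [ev_input hj] at h
      exact ⟨{j}, by simpa using hj, by simpa using Nat.one_le_pow _ _ (by omega),
        fun base' hb he => h (hb j (by simp) b ((ev_input hj).1 he))⟩
    by_cases hn : C.kind j = .notGate
    · obtain ⟨i, hi, hu⟩ := C.existsUnique_of_not j hn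
      obtain ⟨X, h1, h2, h3⟩ := ih (b := !b) (j := i) fun he => h (Or.inr (Or.inl ⟨hn, i, hi, he⟩))
      refine ⟨X, h1, h2.trans hpow, fun base' hb he => ?_⟩
      rcases he with ⟨h5, -⟩ | ⟨-, i', h5, h6⟩ | ⟨h5, -⟩ | ⟨h5, -⟩
      · exact hj h5
      · rw [hu i' h5] at h6
        exact h3 base' hb h6
      · exact hand (h5.symm.trans hn)
      · exact hor (h5.symm.trans hn)
    -- The failure of a universal gate is explained by a single child.
    by_cases ha : C.kind j = (if b then .andGate else .orGate)
    · obtain ⟨i, hi, hne⟩ : ∃ i, C.wire i j ∧ ¬ C.Ev W base d b i := by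
        by_contra! hall
        exact h (Or.inr (Or.inr (Or.inl ⟨ha, hall⟩)))
      obtain ⟨X, h1, h2, h3⟩ := ih hne
      refine ⟨X, h1, h2.trans hpow, fun base' hb he => ?_⟩
      rcases he with ⟨h5, -⟩ | ⟨h5, -⟩ | ⟨-, h5⟩ | ⟨h5, -⟩
      · exact hj h5
      · exact hn h5
      · exact h3 base' hb (h5 i hi)
      · exact hao (ha.symm.trans h5)
    -- The failure of an existential gate rests on all admissible children: at most `R` at a large
    -- gate, where they lie in `W`, and at most two at a small one.
    by_cases ho : C.kind j = (if b then .orGate else .andGate)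
    · have hne : ∀ i, C.wire i j ∧ (C.IsLarge j → W i) → ¬ C.Ev W base d b i := fun i hi he =>
        h (Or.inr (Or.inr (Or.inr ⟨ho, i, hi.1, hi.2, he⟩)))
      choose! f hf1 hf2 hf3 using fun i hi => ih (hne i hi)
      refine ⟨{i | C.wire i j ∧ (C.IsLarge j → W i)}.toFinset.biUnion f, fun x hx => ?_, ?_,
        fun base' hb he => ?_⟩
      · obtain ⟨i, hi, hx⟩ := Finset.mem_biUnion.1 hx
        exact hf1 i (by simpa using hi) x hx
      · refine (Finset.card_biUnion_le_card_mul _ _ ((R + 2) ^ d) fun i hi => ?_).trans ?_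
        · exact hf2 i (by simpa using hi)
        · rw [← Set.ncard_eq_toFinset_card', pow_succ, mul_comm]
          refine Nat.mul_le_mul_left _ ?_
          by_cases hL : C.IsLarge j
          · refine (Set.ncard_le_ncard (t := {i | W i}) (fun i hi => hi.2 hL)
              (Set.toFinite _)).trans (by omega)
          · refine (Set.ncard_le_ncard (t := {i | C.wire i j}) (fun i hi => hi.1)
              (Set.toFinite _)).trans ?_
            have := not_lt.1 hL
            omega
      · rcases he with ⟨h5, -⟩ | ⟨h5, -⟩ | ⟨h5, -⟩ | ⟨-, i, h5, h6, h7⟩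
        · exact hj h5
        · exact hn h5
        · exact ha h5
        · refine hf3 i ⟨h5, h6⟩ base' (fun x hx => hb x ?_) h7
          exact Finset.mem_biUnion.2 ⟨i, by simpa using ⟨h5, h6⟩, hx⟩
    · refine ⟨∅, by simp, by simp, fun base' _ he => ?_⟩
      rcases he with ⟨h5, -⟩ | ⟨h5, -⟩ | ⟨h5, -⟩ | ⟨h5, -⟩
      exacts [hj h5, hn h5, ha h5, ho h5]

end Ev

variable (C) in
/-- The value of a node when the inputs in `S` are true and the others false. -/
def value (S : Fin (C.last + 1) → Prop) (j : Fin (C.last + 1)) : Prop :=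
  match C.kind j with
  | .input => S j
  | .notGate => ∃ i, ∃ _ : C.wire i j, ¬ value S i
  | .andGate => ∀ i, ∀ _ : C.wire i j, value S i
  | .orGate => ∃ i, ∃ _ : C.wire i j, value S i
termination_by j.val
decreasing_by all_goals exact C.lt_of_wire _ _ (by assumption)

theorem value_input {S : Fin (C.last + 1) → Prop} {j : Fin (C.last + 1)}
    (h : C.kind j = .input) : C.value S j ↔ S j := by
  rw [value, h]

theorem isValuation_value (S : Fin (C.last + 1) → Prop) : C.IsValuation (C.value S) := by
  intro j
  cases h : C.kind j with
  | input => trivial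
  | notGate | orGate =>
    simp only
    rw [value, h]
    simp only [exists_prop]
  | andGate =>
    simp only
    rw [value, h]

/-- A weight-`k` satisfying assignment as a set of inputs with a proof that the output is true. -/
theorem hasWeightedSat_iff {h k : ℕ} (hC : C.Bounded h 1 (Fin.last C.last)) :
    C.HasWeightedSat k ↔ ∃ S : Finset (Fin (C.last + 1)), S.card = k ∧
      (∀ x ∈ S, C.kind x = .input) ∧ ∃ W : Finset (Fin (C.last + 1)), W.card ≤ 2 ^ h ∧
        C.Ev (· ∈ W) (fun b x => x ∈ S ↔ b = true) h true (Fin.last C.last) := by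
  classical
  constructor
  · rintro ⟨v, hv, hlast, hk⟩
    refine ⟨{i | C.kind i = .input ∧ v i}.toFinset, ?_, fun x hx => ?_, ?_⟩
    · rwa [← Set.ncard_eq_toFinset_card']
    · exact (by simpa using hx : C.kind x = .input ∧ v x).1
    · obtain ⟨W, h1, -, h2⟩ := exists_ev (b := true) hv
        (base := fun b x => x ∈ {i | C.kind i = .input ∧ v i}.toFinset ↔ b = true)
        (fun b x hx hvx => by simpa [hx] using hvx) le_rfl hC (by simpa using hlast)
      exact ⟨W, h1, h2⟩
  · rintro ⟨S, hS, hinp, W, -, hev⟩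
    refine ⟨C.value (· ∈ S), isValuation_value _, ?_, ?_⟩
    · simpa using hev.sound (isValuation_value (· ∈ S))
        fun b x hx hb => (value_input hx).trans hb
    · rw [← hS, ← Set.ncard_coe_finset S]
      congr 1
      ext x
      constructor
      · rintro ⟨h1, h2⟩
        exact (value_input h1).1 h2
      · exact fun hx => ⟨hinp x hx, (value_input (hinp x hx)).2 hx⟩

end Circuit

/-! ## Decoding -/

theorem ext_cellCode {x y : List Bool} (hlen : x.length = y.length)
    (h : ∀ i < x.length, cellCode x i = cellCode y i) : x = y := by
  refine List.ext_getElem hlen fun i hi hi' => ?_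
  have := h i hi
  simp only [cellCode, List.getElem?_eq_getElem hi, List.getElem?_eq_getElem hi'] at this
  cases hx : x[i] <;> cases hy : y[i] <;> simp_all

theorem cellCode_eq_one_or_two {x : List Bool} {i : ℕ} (h : i < x.length) :
    cellCode x i = 1 ∨ cellCode x i = 2 := by
  have := cellCode_le x i
  have := cellCode_ne_zero_iff.2 h
  omega

theorem length_flatMap_range {f : ℕ → List Bool} {n m : ℕ} (h : ∀ i < n, (f i).length = m) :
    ((List.range n).flatMap f).length = n * m := by
  induction n with
  | zero => simp
  | succ n ih =>
    simp [List.range_succ, ih fun i hi => h i (by omega), h n (by omega), Nat.succ_mul]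

theorem cellCode_flatMap_range {f : ℕ → List Bool} {n m i j : ℕ}
    (h : ∀ i < n, (f i).length = m) (hi : i < n) (hj : j < m) :
    cellCode ((List.range n).flatMap f) (i * m + j) = cellCode (f i) j := by
  induction n with
  | zero => omega
  | succ n ih =>
    have h' : ∀ i < n, (f i).length = m := fun i hi => h i (by omega)
    have hl := length_flatMap_range h'
    rw [List.range_succ, List.flatMap_append, List.flatMap_singleton]
    rcases Nat.lt_succ_iff_lt_or_eq.1 hi with hi | rfl
    · rw [cellCode_append_left, ih h' hi]
      rw [hl]
      calc i * m + j < (i + 1) * m := by rw [Nat.succ_mul]; omega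
        _ ≤ n * m := Nat.mul_le_mul_right _ hi
    · rw [cellCode_append_right (by omega), hl]
      congr 1
      omega

theorem length_encodeNat (n : ℕ) : (encodeNat n).length = n + 1 := by simp [encodeNat]

theorem cellCode_encodeNat_of_lt {n i : ℕ} (h : i < n) : cellCode (encodeNat n) i = 2 := by
  rw [encodeNat, cellCode_append_left (by simpa using h)]
  simp [cellCode, h]

theorem cellCode_encodeNat_self (n : ℕ) : cellCode (encodeNat n) n = 1 := by
  rw [encodeNat, cellCode_append_right (by simp)]
  simp [cellCode]

-- A relation on numbers allows the matrix to be written by loops over ranges.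
open scoped Classical in
theorem encodeMatrix_eq {n : ℕ} {R : Fin n → Fin n → Prop} {R' : ℕ → ℕ → Prop}
    (h : ∀ i j : Fin n, R i j ↔ R' i j) : encodeMatrix R =
      (List.range n).flatMap fun i => (List.range n).map fun j => decide (R' i j) := by
  simp only [encodeMatrix, ← List.map_coe_finRange_eq_range, List.flatMap_map, List.map_map]
  simp [Function.comp_def, h]

theorem length_encodeMatrix {n : ℕ} (R : Fin n → Fin n → Prop) :
    (encodeMatrix R).length = n * n := by
  rw [encodeMatrix_eq (R' := fun i j => ∃ hi hj, R ⟨i, hi⟩ ⟨j, hj⟩) (by simp)]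
  exact length_flatMap_range (by simp)

theorem cellCode_encodeMatrix {n : ℕ} (R : Fin n → Fin n → Prop) (i j : Fin n) :
    cellCode (encodeMatrix R) (i * n + j) = 2 ↔ R i j := by
  rw [encodeMatrix_eq (R' := fun i j => ∃ hi hj, R ⟨i, hi⟩ ⟨j, hj⟩) (by simp),
    cellCode_flatMap_range (by simp) i.2 j.2]
  simp only [cellCode, List.getElem?_map, List.getElem?_range j.2, Option.map_some]
  by_cases h : R i j <;> simp [h]

theorem encodeMatrix_injective {n : ℕ} : Function.Injective (@encodeMatrix n) := by
  intro R R' h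
  ext i j
  rw [← cellCode_encodeMatrix R, h, cellCode_encodeMatrix]

open scoped Classical in
/-- The number of leading ones of a word. -/
noncomputable def nodes (x : List Bool) : ℕ :=
  ∑ i ∈ Finset.range x.length, if ∀ j < i + 1, cellCode x j = 2 then 1 else 0

theorem nodes_eq {x : List Bool} {n : ℕ} (h : ∀ i < n, cellCode x i = 2)
    (hn : cellCode x n ≠ 2) : nodes x = n := by
  classical
  rw [nodes, Finset.sum_boole, Nat.cast_id]
  have : {i ∈ Finset.range x.length | ∀ j < i + 1, cellCode x j = 2} = Finset.range n := by
    ext i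
    simp only [Finset.mem_filter, Finset.mem_range]
    constructor
    · rintro ⟨-, h2⟩
      by_contra hi
      exact hn (h2 n (by omega))
    · intro hi
      refine ⟨cellCode_ne_zero_iff.1 (by rw [h i hi]; simp), fun j hj => h j (by omega)⟩
  rw [this, Finset.card_range]

theorem nodes_spec (x : List Bool) :
    (∀ i < nodes x, cellCode x i = 2) ∧ cellCode x (nodes x) ≠ 2 := by
  classical
  have hex : ∃ n, cellCode x n ≠ 2 := ⟨x.length, by simp [cellCode]⟩
  have h1 : ∀ i < Nat.find hex, cellCode x i = 2 := fun i hi => not_not.1 (Nat.find_min hex hi)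
  rw [nodes_eq h1 (Nat.find_spec hex)]
  exact ⟨h1, Nat.find_spec hex⟩

theorem nodes_encodeNat_append (n : ℕ) (l : List Bool) : nodes (encodeNat n ++ l) = n := by
  refine nodes_eq (fun i hi => ?_) ?_
  · rw [cellCode_append_left (by rw [length_encodeNat]; omega), cellCode_encodeNat_of_lt hi]
  · rw [cellCode_append_left (by rw [length_encodeNat]; omega), cellCode_encodeNat_self]
    simp

/-- The leading ones determine n, and then the length n² of each matrix determines where the word is
to be cut. -/
theorem encodeVCU2_injective {n n' : ℕ} {G : SimpleGraph (Fin n)} {G' : SimpleGraph (Fin n')}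
    {M : G.Subgraph} {M' : G'.Subgraph} (h : encodeVCU2 G M = encodeVCU2 G' M') :
    ∃ hn : n' = n, (∀ i j, G'.Adj i j ↔ G.Adj (Fin.cast hn i) (Fin.cast hn j)) ∧
      ∀ i j, M'.Adj i j ↔ M.Adj (Fin.cast hn i) (Fin.cast hn j) := by
  rw [encodeVCU2, encodeVCU2, List.append_assoc, List.append_assoc] at h
  obtain rfl : n = n' := by
    rw [← nodes_encodeNat_append n, h, nodes_encodeNat_append]
  obtain ⟨h1, h2⟩ := List.append_inj (List.append_cancel_left h)
    (by rw [length_encodeMatrix, length_encodeMatrix])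
  have h1 := encodeMatrix_injective h1
  have h2 := encodeMatrix_injective h2
  exact ⟨rfl, by simp [h1], by simp [h2]⟩

open Classical in
/-- The kind of node `j` of the circuit encoded by `x`. -/
noncomputable def kindAt (x : List Bool) (j : ℕ) : NodeKind :=
  if cellCode x (nodes x + 1 + (j * 2 + 0)) = 1 then
    if cellCode x (nodes x + 1 + (j * 2 + 1)) = 1 then .input else .notGate
  else if cellCode x (nodes x + 1 + (j * 2 + 1)) = 1 then .andGate else .orGate

/-- The wires of the circuit encoded by `x`. -/
def wireAt (x : List Bool) (i j : ℕ) : Prop :=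
  cellCode x (nodes x + 1 + nodes x * 2 + (i * nodes x + j)) = 2

def largeAt (x : List Bool) (j : ℕ) : Prop :=
  ∃ a < nodes x, ∃ b < nodes x, ∃ c < nodes x, wireAt x a j ∧ wireAt x b j ∧ wireAt x c j ∧
    a ≠ b ∧ a ≠ c ∧ b ≠ c

/-- Here and in `evAt` the recursions `Circuit.Bounded` and `Circuit.Ev` are read off an arbitrary
word, with bounded quantifiers over numbers, so that the closure properties of `PolyDec` apply. -/
def boundedAt (x : List Bool) : ℕ → ℕ → ℕ → Prop
  | 0, _, j => kindAt x j = .input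
  | d + 1, w, j => kindAt x j = .input ∨ (largeAt x j → 0 < w) ∧ ∀ i < nodes x, wireAt x i j →
      (largeAt x j → boundedAt x d (w - 1) i) ∧ (¬ largeAt x j → boundedAt x d w i)

def evAt (x : List Bool) (W : ℕ → Prop) (base : Bool → ℕ → Prop) : ℕ → Bool → ℕ → Prop
  | 0, b, j => kindAt x j = .input ∧ base b j
  | d + 1, b, j => (kindAt x j = .input ∧ base b j) ∨
      (kindAt x j = .notGate ∧ ∃ i < nodes x, wireAt x i j ∧ evAt x W base d (!b) i) ∨
      (kindAt x j = (if b then .andGate else .orGate) ∧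
        ∀ i < nodes x, wireAt x i j → evAt x W base d b i) ∨
      (kindAt x j = (if b then .orGate else .andGate) ∧
        ∃ i < nodes x, wireAt x i j ∧ (largeAt x j → W i) ∧ evAt x W base d b i)

/-- The word `x` encodes a circuit of weft at most one and depth at most `h`. -/
def WellFormed (h : ℕ) (x : List Bool) : Prop :=
  0 < nodes x ∧ x.length = nodes x + 1 + nodes x * 2 + nodes x * nodes x ∧
    (∀ j < nodes x, ∀ i < nodes x, wireAt x i j → i < j ∧ kindAt x j ≠ .input) ∧
    (∀ j < nodes x, kindAt x j ≠ .input → ∃ i < nodes x, wireAt x i j) ∧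
    (∀ j < nodes x, kindAt x j = .notGate → ∀ i < nodes x, ∀ i' < nodes x,
      wireAt x i j → wireAt x i' j → i = i') ∧
    boundedAt x h 1 (nodes x - 1)

/-! ### Decoding inverts encoding -/

namespace Circuit

variable (C : Circuit)

theorem length_encodeKind (κ : NodeKind) : (encodeKind κ).length = 2 := by cases κ <;> rfl

theorem encode_eq : C.encode = encodeNat (C.last + 1) ++
    ((List.range (C.last + 1)).flatMap fun i =>
      if h : i < C.last + 1 then encodeKind (C.kind ⟨i, h⟩) else []) ++ encodeMatrix C.wire := by
  simp only [encode, ← List.map_coe_finRange_eq_range, List.flatMap_map, Fin.is_lt, dite_true,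
    Fin.eta]

theorem length_kinds : ((List.range (C.last + 1)).flatMap fun i =>
    if h : i < C.last + 1 then encodeKind (C.kind ⟨i, h⟩) else []).length = (C.last + 1) * 2 :=
  length_flatMap_range fun i hi => by rw [dif_pos hi, length_encodeKind]

theorem nodes_encode : nodes C.encode = C.last + 1 := by
  rw [encode, List.append_assoc, nodes_encodeNat_append]

theorem length_encode : C.encode.length =
    C.last + 1 + 1 + (C.last + 1) * 2 + (C.last + 1) * (C.last + 1) := by
  rw [encode_eq, List.length_append, List.length_append, length_encodeNat, length_kinds,
    length_encodeMatrix]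

theorem cellCode_encode_kind (j : Fin (C.last + 1)) {e : ℕ} (he : e < 2) :
    cellCode C.encode (C.last + 1 + 1 + (j * 2 + e)) = cellCode (encodeKind (C.kind j)) e := by
  have := j.2
  rw [encode_eq, cellCode_append_left, cellCode_append_right, length_encodeNat,
    Nat.add_sub_cancel_left,
    cellCode_flatMap_range (fun i hi => by rw [dif_pos hi, length_encodeKind]) j.2 he, dif_pos j.2]
  · rw [length_encodeNat]; omega
  · rw [List.length_append, length_encodeNat, length_kinds]; omega

theorem cellCode_encode_wire (k : ℕ) :
    cellCode C.encode (C.last + 1 + 1 + (C.last + 1) * 2 + k) =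
      cellCode (encodeMatrix C.wire) k := by
  have hl : C.last + 1 + 1 + (C.last + 1) * 2 = (encodeNat (C.last + 1) ++
    ((List.range (C.last + 1)).flatMap fun i =>
      if h : i < C.last + 1 then encodeKind (C.kind ⟨i, h⟩) else [])).length := by
    rw [List.length_append, length_encodeNat, length_kinds]
  rw [encode_eq, cellCode_append_right (by omega), ← hl, Nat.add_sub_cancel_left]

theorem kindAt_encode (j : Fin (C.last + 1)) : kindAt C.encode j = C.kind j := by
  rw [kindAt, nodes_encode, cellCode_encode_kind _ _ (by omega),
    cellCode_encode_kind _ _ (by omega)]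
  cases C.kind j <;> simp [encodeKind, cellCode]

theorem wireAt_encode (i j : Fin (C.last + 1)) : wireAt C.encode i j ↔ C.wire i j := by
  rw [wireAt, nodes_encode, cellCode_encode_wire, cellCode_encodeMatrix]

theorem largeAt_encode (j : Fin (C.last + 1)) : largeAt C.encode j ↔ C.IsLarge j := by
  rw [IsLarge, Set.two_lt_ncard_iff (Set.toFinite _), largeAt, nodes_encode]
  constructor
  · rintro ⟨a, ha, b, hb, c, hc, h1, h2, h3, h4, h5, h6⟩
    exact ⟨⟨a, ha⟩, ⟨b, hb⟩, ⟨c, hc⟩, (C.wireAt_encode ⟨a, ha⟩ j).1 h1,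
      (C.wireAt_encode ⟨b, hb⟩ j).1 h2, (C.wireAt_encode ⟨c, hc⟩ j).1 h3, by simpa using h4,
      by simpa using h5, by simpa using h6⟩
  · rintro ⟨a, b, c, h1, h2, h3, h4, h5, h6⟩
    exact ⟨a, a.2, b, b.2, c, c.2, (C.wireAt_encode a j).2 h1, (C.wireAt_encode b j).2 h2,
      (C.wireAt_encode c j).2 h3, Fin.val_ne_of_ne h4, Fin.val_ne_of_ne h5, Fin.val_ne_of_ne h6⟩

theorem boundedAt_encode {d w : ℕ} (j : Fin (C.last + 1)) :
    boundedAt C.encode d w j ↔ C.Bounded d w j := by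
  induction d generalizing w j with
  | zero => rw [boundedAt, Bounded, kindAt_encode]
  | succ d ih =>
    simp only [boundedAt, Bounded, kindAt_encode, largeAt_encode, nodes_encode]
    refine or_congr_right (and_congr_right fun _ => ?_)
    rw [Fin.forall_iff]
    refine forall₂_congr fun i hi => ?_
    rw [← wireAt_encode, ← ih, ← ih]

theorem evAt_encode {W : ℕ → Prop} {base : Bool → ℕ → Prop} {d : ℕ} {b : Bool}
    (j : Fin (C.last + 1)) :
    evAt C.encode W base d b j ↔ C.Ev (fun i => W i) (fun b i => base b i) d b j := by
  induction d generalizing b j with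
  | zero => rw [evAt, Ev, kindAt_encode]
  | succ d ih =>
    simp only [evAt, Ev, kindAt_encode, largeAt_encode, nodes_encode, Fin.forall_iff,
      Fin.exists_iff, ← ih, ← wireAt_encode, exists_prop]

end Circuit

/-- A word of the right length is determined by its number of nodes, its kinds and its wires, so it
is the code of the circuit read off it as soon as these satisfy the circuit axioms. -/
theorem wellFormed_iff {h : ℕ} {x : List Bool} : WellFormed h x ↔
    ∃ C : Circuit, x = C.encode ∧ C.Bounded h 1 (Fin.last C.last) := by
  constructor
  · rintro ⟨hpos, hlen, h1, h2, h3, h4⟩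
    obtain ⟨l, hl⟩ : ∃ l, nodes x = l + 1 := ⟨nodes x - 1, by omega⟩
    let C : Circuit :=
      { last := l
        kind := fun j => kindAt x j
        wire := fun i j => wireAt x i j
        lt_of_wire := fun i j h => (h1 j (by omega) i (by omega) h).1
        no_wire_to_input := fun i j hj h => (h1 j (by omega) i (by omega) h).2 hj
        existsUnique_of_not := fun j hj => by
          obtain ⟨i, hi, hw⟩ := h2 j (by omega) (by simp [hj])
          exact ⟨⟨i, by omega⟩, hw, fun i' hw' =>
            Fin.ext (h3 j (by omega) hj i' (by omega) i hi hw' hw)⟩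
        exists_of_and := fun j hj => by
          obtain ⟨i, hi, hw⟩ := h2 j (by omega) (by simp [hj])
          exact ⟨⟨i, by omega⟩, hw⟩
        exists_of_or := fun j hj => by
          obtain ⟨i, hi, hw⟩ := h2 j (by omega) (by simp [hj])
          exact ⟨⟨i, by omega⟩, hw⟩ }
    -- The words are compared cell by cell: leading ones, separating zero, kinds, matrix. Inside the
    -- word only the codes 1 and 2 occur, so agreement on one of them suffices.
    have hx : x = C.encode := by
      obtain ⟨hx1, hx2⟩ := nodes_spec x
      rw [hl] at hlen hx1 hx2
      refine ext_cellCode (hlen.trans C.length_encode.symm) fun i hi => ?_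
      have hn := nodes_spec C.encode
      rw [C.nodes_encode] at hn
      rcases lt_trichotomy i (l + 1) with hi1 | rfl | hi1
      · rw [hx1 i hi1, hn.1 i hi1]
      · have h1 := cellCode_eq_one_or_two hi
        have h2 := cellCode_eq_one_or_two (x := C.encode) (i := l + 1)
          (by rw [C.length_encode]; change l + 1 < l + 1 + 1 + _ + _; omega)
        have h3 := hn.2
        change cellCode C.encode (l + 1) ≠ 2 at h3
        omega
      obtain ⟨k, rfl⟩ := Nat.exists_eq_add_of_le (show l + 1 + 1 ≤ i from hi1)
      rcases lt_or_ge k ((l + 1) * 2) with hk | hk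
      · have hj : k / 2 < l + 1 := by omega
        have hk2 := cellCode_eq_one_or_two (x := x) (i := l + 1 + 1 + (k / 2 * 2 + 0)) (by omega)
        have hk3 := cellCode_eq_one_or_two (x := x) (i := l + 1 + 1 + (k / 2 * 2 + 1)) (by omega)
        have key := C.cellCode_encode_kind ⟨k / 2, hj⟩ (e := k % 2) (Nat.mod_lt _ (by omega))
        simp only at key
        rw [show k / 2 * 2 + k % 2 = k by omega] at key
        refine Eq.trans ?_ key.symm
        change _ = cellCode (Circuit.encodeKind (kindAt x (k / 2))) _
        rw [kindAt, hl]
        rcases Nat.mod_two_eq_zero_or_one k with he | he <;> rw [he]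
        · rw [show k = k / 2 * 2 + 0 by omega]
          simp only [show (k / 2 * 2 + 0) / 2 = k / 2 by omega]
          rcases hk2 with hk2 | hk2 <;> rcases hk3 with hk3 | hk3 <;> rw [hk2, hk3] <;>
            simp [Circuit.encodeKind, cellCode]
        · rw [show k = k / 2 * 2 + 1 by omega]
          simp only [show (k / 2 * 2 + 1) / 2 = k / 2 by omega]
          rcases hk2 with hk2 | hk2 <;> rcases hk3 with hk3 | hk3 <;> rw [hk2, hk3] <;>
            simp [Circuit.encodeKind, cellCode]
      · obtain ⟨k, rfl⟩ := Nat.exists_eq_add_of_le hk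
        rw [← add_assoc] at hi ⊢
        refine Eq.trans ?_ (C.cellCode_encode_wire k).symm
        have hkl : k < (l + 1) * (l + 1) := by omega
        have hi' : k / (l + 1) < l + 1 := Nat.div_lt_of_lt_mul hkl
        have hj' : k % (l + 1) < l + 1 := Nat.mod_lt _ (by omega)
        have key := cellCode_encodeMatrix C.wire ⟨_, hi'⟩ ⟨_, hj'⟩
        have hdm : k / (l + 1) * (C.last + 1) + k % (l + 1) = k := Nat.div_add_mod' k (l + 1)
        simp only [hdm] at key
        have key2 : C.wire ⟨_, hi'⟩ ⟨_, hj'⟩ ↔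
            cellCode x (l + 1 + 1 + (l + 1) * 2 + k) = 2 := by
          change wireAt x _ _ ↔ _
          rw [wireAt, hl, Nat.div_add_mod']
        have h1 := cellCode_eq_one_or_two hi
        have h2 := cellCode_eq_one_or_two (x := encodeMatrix C.wire) (i := k)
          (by rw [length_encodeMatrix]; exact hkl)
        rw [key2] at key
        omega
    refine ⟨C, hx, ?_⟩
    rw [← C.boundedAt_encode, ← hx]
    rwa [hl] at h4
  · rintro ⟨C, rfl, hC⟩
    rw [WellFormed, C.nodes_encode]
    refine ⟨by omega, C.length_encode, fun j hj i hi hw => ?_, fun j hj hk => ?_,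
      fun j hj hk i hi i' hi' hw hw' => ?_, ?_⟩
    · have hw := (C.wireAt_encode ⟨i, hi⟩ ⟨j, hj⟩).1 hw
      refine ⟨C.lt_of_wire _ _ hw, fun hk => C.no_wire_to_input _ ⟨j, hj⟩ ?_ hw⟩
      rw [← C.kindAt_encode, hk]
    · rw [C.kindAt_encode ⟨j, hj⟩] at hk
      obtain ⟨i, hi⟩ : ∃ i, C.wire i ⟨j, hj⟩ := by
        cases hk' : C.kind ⟨j, hj⟩ with
        | input => exact absurd hk' hk
        | notGate => exact (C.existsUnique_of_not _ hk').exists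
        | andGate => exact C.exists_of_and _ hk'
        | orGate => exact C.exists_of_or _ hk'
      exact ⟨i, i.2, (C.wireAt_encode i ⟨j, hj⟩).2 hi⟩
    · rw [C.kindAt_encode ⟨j, hj⟩] at hk
      have := (C.existsUnique_of_not _ hk).unique ((C.wireAt_encode ⟨i, hi⟩ ⟨j, hj⟩).1 hw)
        ((C.wireAt_encode ⟨i', hi'⟩ ⟨j, hj⟩).1 hw')
      simpa using this
    · exact (C.boundedAt_encode (Fin.last C.last)).2 hC

/-! ### The decoding in polynomial time -/

section PolyTime

variable {α : Type} [Ctx α] {f g : α → ℕ}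

open Ctx

theorem polyTime_nodes : PolyTime fun a : α => nodes (inst a).word := by
  classical
  have h : PolyDec fun q : α × ℕ => ∀ j < q.2 + 1, cellCode (inst q).word j = 2 :=
    .ball (P := fun q j => cellCode (inst q).word j = 2) (PolyTime.snd.add (.const 1))
      (.eq (PolyTime.cell PolyTime.snd) (.const 2))
  exact (PolyTime.length.sum (f := fun a i =>
    if ∀ j < i + 1, cellCode (inst a).word j = 2 then 1 else 0) h.polyTime).congr fun a => by
      unfold nodes; congr

theorem polyDec_kindAt (hf : PolyTime f) (κ : NodeKind) :
    PolyDec fun a => kindAt (inst a).word (f a) = κ := by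
  have h : ∀ e, PolyDec fun a =>
      cellCode (inst a).word (nodes (inst a).word + 1 + (f a * 2 + e)) = 1 := fun e =>
    .eq (.cell ((polyTime_nodes.add (.const 1)).add ((hf.mul (.const 2)).add (.const e))))
      (.const 1)
  cases κ with
  | input => exact ((h 0).and (h 1)).congr fun a => by unfold kindAt; split_ifs <;> simp_all
  | notGate => exact ((h 0).and (h 1).not).congr fun a => by unfold kindAt; split_ifs <;> simp_all
  | andGate => exact ((h 0).not.and (h 1)).congr fun a => by unfold kindAt; split_ifs <;> simp_all
  | orGate =>
    exact ((h 0).not.and (h 1).not).congr fun a => by unfold kindAt; split_ifs <;> simp_all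

theorem polyDec_wireAt (hf : PolyTime f) (hg : PolyTime g) :
    PolyDec fun a => wireAt (inst a).word (f a) (g a) :=
  .eq (.cell (((polyTime_nodes.add (.const 1)).add (polyTime_nodes.mul (.const 2))).add
    ((hf.mul polyTime_nodes).add hg))) (.const 2)

theorem polyDec_largeAt (hf : PolyTime f) : PolyDec fun a => largeAt (inst a).word (f a) := by
  refine .bex (P := fun a i => _) polyTime_nodes (.bex (P := fun a i => _) polyTime_nodes
    (.bex (P := fun a i => _) polyTime_nodes ?_))
  have ha : PolyTime fun q : ((α × ℕ) × ℕ) × ℕ => q.1.1.2 := PolyTime.snd.fst.fst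
  have hb : PolyTime fun q : ((α × ℕ) × ℕ) × ℕ => q.1.2 := PolyTime.snd.fst
  have hc : PolyTime fun q : ((α × ℕ) × ℕ) × ℕ => q.2 := PolyTime.snd
  have hj : PolyTime fun q : ((α × ℕ) × ℕ) × ℕ => f q.1.1.1 := hf.fst.fst.fst
  exact (polyDec_wireAt ha hj).and ((polyDec_wireAt hb hj).and ((polyDec_wireAt hc hj).and
    ((PolyDec.eq ha hb).not.and ((PolyDec.eq ha hc).not.and (PolyDec.eq hb hc).not))))

/-- The depth is constant, so the recursion unfolds to a fixed number of nested bounded quantifiers.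
-/
theorem polyDec_boundedAt (d w : ℕ) (hf : PolyTime f) :
    PolyDec fun a => boundedAt (inst a).word d w (f a) := by
  induction d generalizing α w with
  | zero => exact polyDec_kindAt hf _
  | succ d ih =>
    refine (polyDec_kindAt hf _).or (((polyDec_largeAt hf).imp (.const _)).and
      (.ball (P := fun a i => _) polyTime_nodes ?_))
    exact (polyDec_wireAt .snd hf.fst).imp (((polyDec_largeAt hf.fst).imp (ih _ .snd)).and
      ((polyDec_largeAt hf.fst).not.imp (ih _ .snd)))

/-- The hypotheses range over all contexts because every level of the recursion adds a bound
variable. -/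
theorem polyDec_evAt {W : Inst → ℕ → ℕ → Prop} {base : Inst → ℕ → Bool → ℕ → Prop}
    (hW : ∀ {α : Type} [Ctx α] {f g : α → ℕ}, PolyTime f → PolyTime g →
      PolyDec fun a => W (inst a) (f a) (g a))
    (hbase : ∀ {α : Type} [Ctx α] {f g : α → ℕ} (b : Bool), PolyTime f → PolyTime g →
      PolyDec fun a => base (inst a) (f a) b (g a))
    (d : ℕ) (b : Bool) (hf : PolyTime f) (hg : PolyTime g) :
    PolyDec fun a => evAt (inst a).word (W (inst a) (f a)) (base (inst a) (f a)) d b (g a) := by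
  induction d generalizing α b with
  | zero => exact (polyDec_kindAt hg _).and (hbase b hf hg)
  | succ d ih =>
    refine ((polyDec_kindAt hg _).and (hbase b hf hg)).or
      (((polyDec_kindAt hg _).and (.bex (P := fun a i => _) polyTime_nodes ?_)).or
      (((polyDec_kindAt hg _).and (.ball (P := fun a i => _) polyTime_nodes ?_)).or
      ((polyDec_kindAt hg _).and (.bex (P := fun a i => _) polyTime_nodes ?_))))
    · exact (polyDec_wireAt .snd hg.fst).and (ih (!b) hf.fst .snd)
    · exact (polyDec_wireAt .snd hg.fst).imp (ih b hf.fst .snd)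
    · exact (polyDec_wireAt .snd hg.fst).and
        (((polyDec_largeAt hg.fst).imp (hW hf.fst .snd)).and (ih b hf.fst .snd))

theorem polyDec_wellFormed (h : ℕ) : PolyDec fun a : α => WellFormed h (inst a).word := by
  refine (PolyDec.lt (.const 0) polyTime_nodes).and ((PolyDec.eq .length
    (((polyTime_nodes.add (.const 1)).add (polyTime_nodes.mul (.const 2))).add
      (polyTime_nodes.mul polyTime_nodes))).and
    ((PolyDec.ball (P := fun a i => _) polyTime_nodes
      (.ball (P := fun a i => _) polyTime_nodes ?_)).and
    ((PolyDec.ball (P := fun a i => _) polyTime_nodes ?_).and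
    ((PolyDec.ball (P := fun a i => _) polyTime_nodes ?_).and
      (polyDec_boundedAt h 1 (polyTime_nodes.sub (.const 1)))))))
  · exact (polyDec_wireAt .snd PolyTime.snd.fst).imp
      ((PolyDec.lt .snd PolyTime.snd.fst).and (polyDec_kindAt PolyTime.snd.fst _).not)
  · exact (polyDec_kindAt .snd _).not.imp (.bex (P := fun a i => _) polyTime_nodes
      (polyDec_wireAt .snd PolyTime.snd.fst))
  · exact (polyDec_kindAt .snd _).imp (.ball (P := fun a i => _) polyTime_nodes
      (.ball (P := fun a i => _) polyTime_nodes
        ((polyDec_wireAt PolyTime.snd.fst PolyTime.snd.fst.fst).imp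
          ((polyDec_wireAt .snd PolyTime.snd.fst.fst).imp (.eq PolyTime.snd.fst .snd)))))

end PolyTime

/-! ## The graph of a weighted satisfiability instance

The `k` true inputs are placed in increasing order in the slots `1, …, k`, between two sentinels
in the slots `0` and `k + 1`; input `x` is represented by the value `x + 1`. A vertex of the graph
specifies the contents of `Q` slots and the same list of `R` nodes as all other vertices. -/

/-- A small set is padded to a list of fixed length; used for the nodes in W and for sets of slots.
-/
theorem exists_enumeration {α : Type*} (Z : Finset α) {Q : ℕ} (hZ : Z.card ≤ Q) (a : α) :
    ∃ τ : ℕ → α, (∀ z ∈ Z, ∃ i < Q, τ i = z) ∧ ∀ i, τ i ∈ Z ∨ τ i = a := by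
  refine ⟨fun i => if hi : i < Z.card then Z.equivFin.symm ⟨i, hi⟩ else a, fun z hz => ?_,
    fun i => ?_⟩
  · have := (Z.equivFin ⟨z, hz⟩).2
    exact ⟨Z.equivFin ⟨z, hz⟩, by omega, by simp⟩
  · by_cases hi : i < Z.card <;> simp [hi]

theorem exists_digits {B m : ℕ} {D : ℕ → ℕ} (hD : ∀ i < m, D i < B) :
    ∃ v < B ^ m, ∀ i < m, v / B ^ i % B = D i := by
  let f : Fin m → Fin B := fun i => ⟨D i, hD i i.2⟩
  refine ⟨finFunctionFinEquiv f, Fin.is_lt _, fun i hi => ?_⟩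
  exact congrArg Fin.val (congrFun (finFunctionFinEquiv.symm_apply_apply f) ⟨i, hi⟩)

section Graph

/-- Large enough for slot numbers, at most k + 1, and for contents and choices, at most `nodes
y.word + 1`. -/
noncomputable def digitBase (y : Inst) : ℕ := nodes y.word + y.param + 2

noncomputable def digit (y : Inst) (v i : ℕ) : ℕ := v / digitBase y ^ i % digitBase y

variable (h Q R : ℕ) (y : Inst)

noncomputable def slot (v i : ℕ) : ℕ := digit y v i

noncomputable def val (v i : ℕ) : ℕ := digit y v (Q + i)

noncomputable def choice (v i : ℕ) : ℕ := digit y v (2 * Q + i)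

def KnownTrue (v x : ℕ) : Prop := ∃ i < Q, val Q y v i = x + 1

/-- Adjacent slots hold consecutive true inputs, so an input strictly between their contents is
false. -/
def KnownFalse (v x : ℕ) : Prop := ∃ i < Q, ∃ j < Q, slot y v j = slot y v i + 1 ∧
  val Q y v i < x + 1 ∧ x + 1 < val Q y v j

/-- According to `v`, input `x` may have value `b`. -/
def MayBe (v : ℕ) (b : Bool) (x : ℕ) : Prop :=
  (b = true → ¬ KnownFalse Q y v x) ∧ (b = false → ¬ KnownTrue Q y v x)

/-- The shift by one reserves 0 for unused positions. -/
def Chosen (v x : ℕ) : Prop := ∃ i < R, choice Q y v i = x + 1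

/-- The contents must be increasing inputs between the sentinels 0 and `nodes y.word + 1`. `MayBe`
grants an undetermined input both values, so the last condition says that the visible slots do not
refute the chosen nodes. -/
def ValidVertex (v : ℕ) : Prop :=
  WellFormed h y.word ∧ v < digitBase y ^ (2 * Q + R) ∧
    (∀ i < Q, slot y v i < y.param + 2 ∧ (slot y v i = 0 → val Q y v i = 0) ∧
      (slot y v i = y.param + 1 → val Q y v i = nodes y.word + 1) ∧
      (slot y v i ≠ 0 → slot y v i ≠ y.param + 1 → val Q y v i ≠ 0 ∧ val Q y v i ≤ nodes y.word ∧
        kindAt y.word (val Q y v i - 1) = .input)) ∧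
    (∀ i < Q, ∀ j < Q, (slot y v i < slot y v j → val Q y v i < val Q y v j) ∧
      (slot y v i = slot y v j → val Q y v i = val Q y v j)) ∧
    evAt y.word (Chosen Q R y v) (MayBe Q y v) h true (nodes y.word - 1)

/-- The alternatives force, in this order, that an independent set has at most one vertex per tuple
of slots, one common choice of nodes, and one content per slot. -/
def Conflict (u v : ℕ) : Prop :=
  (∀ i < Q, slot y u i = slot y v i) ∨ (∃ i < R, choice Q y u i ≠ choice Q y v i) ∨
    ∃ i < Q, ∃ j < Q, slot y u i = slot y v j ∧ val Q y u i ≠ val Q y v j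

/-- An invalid vertex is adjacent to all others, so no independent set with two elements contains
it. -/
def AdjAt (u v : ℕ) : Prop :=
  u ≠ v ∧ (¬ ValidVertex h Q R y u ∨ ¬ ValidVertex h Q R y v ∨ Conflict Q R y u v)

def MatchAt (u v : ℕ) : Prop :=
  u + digitBase y ^ (2 * Q + R) = v ∨ v + digitBase y ^ (2 * Q + R) = u

variable {h Q R y}

theorem Conflict.symm {u v : ℕ} : Conflict Q R y u v → Conflict Q R y v u := by
  rintro (h1 | ⟨i, hi, h1⟩ | ⟨i, hi, j, hj, h1, h2⟩)
  · exact Or.inl fun i hi => (h1 i hi).symm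
  · exact Or.inr (Or.inl ⟨i, hi, h1.symm⟩)
  · exact Or.inr (Or.inr ⟨j, hj, i, hi, h1.symm, h2.symm⟩)

theorem AdjAt.symm {u v : ℕ} : AdjAt h Q R y u v → AdjAt h Q R y v u := by
  rintro ⟨h1, h2 | h2 | h2⟩
  exacts [⟨h1.symm, Or.inr (Or.inl h2)⟩, ⟨h1.symm, Or.inl h2⟩,
    ⟨h1.symm, Or.inr (Or.inr h2.symm)⟩]

theorem digitBase_pow_pos : 0 < digitBase y ^ (2 * Q + R) :=
  Nat.pow_pos (by unfold digitBase; omega)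

/-- One end of a matching edge lies in the upper half of the vertices, which `ValidVertex` excludes.
-/
theorem MatchAt.adjAt {u v : ℕ} (huv : MatchAt Q R y u v) : AdjAt h Q R y u v := by
  have := digitBase_pow_pos (Q := Q) (R := R) (y := y)
  rcases huv with huv | huv
  · exact ⟨by omega, Or.inr (Or.inl fun hv => absurd hv.2.1 (by omega))⟩
  · exact ⟨by omega, Or.inl fun hv => absurd hv.2.1 (by omega)⟩

/-! ### The graph and its perfect matching -/

variable (h Q R y)

def vertexGraph : SimpleGraph (Fin (2 * digitBase y ^ (2 * Q + R))) where
  Adj u v := AdjAt h Q R y u v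
  symm := ⟨fun _ _ huv => huv.symm⟩
  loopless := ⟨fun _ hu => hu.1 rfl⟩

def vertexMatching : (vertexGraph h Q R y).Subgraph where
  verts := Set.univ
  Adj u v := MatchAt Q R y u v
  adj_sub huv := huv.adjAt
  edge_vert _ := trivial
  symm := ⟨fun _ _ huv => huv.symm⟩

/-- The matching is perfect, so a larger matching has no room for another edge. -/
theorem isMaximalMatching_vertexMatching : IsMaximalMatching (vertexMatching h Q R y) := by
  have hM : (vertexMatching h Q R y).IsMatching := by
    intro u _
    have hu := u.2
    rcases lt_or_ge u.1 (digitBase y ^ (2 * Q + R)) with hlt | hge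
    · refine ⟨⟨u + digitBase y ^ (2 * Q + R), by omega⟩, Or.inl rfl, ?_⟩
      rintro ⟨v, hv⟩ (huv | huv)
      · exact Fin.ext huv.symm
      · simp only at huv; omega
    · refine ⟨⟨u - digitBase y ^ (2 * Q + R), by omega⟩, Or.inr (by simp; omega), ?_⟩
      rintro ⟨v, hv⟩ (huv | huv)
      · simp only at huv; omega
      · ext; simp only at huv ⊢; omega
  refine ⟨hM, fun M' hM' hle => ⟨Set.subset_univ _, fun u v huv => ?_⟩⟩
  obtain ⟨w, hw, -⟩ := hM (Set.mem_univ u)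
  rwa [(hM' (M'.edge_vert huv)).unique huv (hle.2 hw)]

theorem ncard_edgeSet_vertexMatching :
    (vertexMatching h Q R y).edgeSet.ncard = digitBase y ^ (2 * Q + R) := by
  set N := digitBase y ^ (2 * Q + R) with hN
  have hpos : 0 < N := digitBase_pow_pos
  let e : Fin N → Sym2 (Fin (2 * digitBase y ^ (2 * Q + R))) := fun i =>
    s(⟨i, by omega⟩, ⟨i + N, by omega⟩)
  have he : Function.Injective e := by
    intro i j hij
    simp only [e, Sym2.eq_iff, Fin.mk.injEq] at hij
    ext
    omega
  have : (vertexMatching h Q R y).edgeSet = Set.range e := by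
    ext z
    induction z with | _ u v
    have hu := u.2
    have hv := v.2
    simp only [SimpleGraph.Subgraph.mem_edgeSet, Set.mem_range, e, Sym2.eq_iff, Fin.ext_iff]
    change (u + N = (v : ℕ) ∨ v + N = (u : ℕ)) ↔ _
    constructor
    · rintro (huv | huv)
      · exact ⟨⟨u, by omega⟩, Or.inl ⟨rfl, huv⟩⟩
      · exact ⟨⟨v, by omega⟩, Or.inr ⟨rfl, huv⟩⟩
    · rintro ⟨i, h⟩
      omega
  rw [this, ← Nat.card_coe_set_eq, Nat.card_range_of_injective he, Nat.card_fin]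

end Graph

/-! ### From a satisfying assignment to an independent set -/

section Correctness

variable {h Q R : ℕ} {y : Inst}

theorem exists_vertex {s A c : ℕ → ℕ} (hs : ∀ i < Q, s i < y.param + 2)
    (hA : ∀ t < y.param + 2, A t ≤ nodes y.word + 1) (hc : ∀ i < R, c i ≤ nodes y.word) :
    ∃ v < digitBase y ^ (2 * Q + R), (∀ i < Q, slot y v i = s i) ∧
      (∀ i < Q, val Q y v i = A (s i)) ∧ ∀ i < R, choice Q y v i = c i := by
  let D : ℕ → ℕ := fun i =>
    if i < Q then s i else if i < 2 * Q then A (s (i - Q)) else c (i - 2 * Q)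
  obtain ⟨v, hv, hD⟩ := exists_digits (B := digitBase y) (m := 2 * Q + R) (D := D) (by
    intro i hi
    simp only [D, digitBase]
    split_ifs with h1 h2
    · have := hs i h1; omega
    · have := hA _ (hs (i - Q) (by omega)); omega
    · have := hc (i - 2 * Q) (by omega); omega)
  refine ⟨v, hv, fun i hi => ?_, fun i hi => ?_, fun i hi => ?_⟩
  · rw [slot, digit, hD i (by omega)]
    simp [D, hi]
  · rw [val, digit, hD _ (by omega)]
    simp only [D]
    rw [if_neg (by omega), if_pos (by omega), Nat.add_sub_cancel_left]
  · rw [choice, digit, hD _ (by omega)]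
    simp only [D]
    rw [if_neg (by omega), if_neg (by omega), Nat.add_sub_cancel_left]

/-- Each tuple of slots gets the vertex with the actual contents and the choices of one fixed proof.
All contents come from a single function `A` of the slot, so no two of these vertices conflict. -/
theorem exists_independent_of_mem (hy : (y.word, y.param) ∈ weightedCircuitSat 1 h) :
    ∃ I : Finset ℕ, I.card = (y.param + 2) ^ Q ∧ (∀ v ∈ I, v < digitBase y ^ (2 * Q + 2 ^ h)) ∧
      ∀ u ∈ I, ∀ v ∈ I, ¬ AdjAt h Q (2 ^ h) y u v := by
  classical
  obtain ⟨C, hw, hd, hx, hsat⟩ := hy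
  have hb := Circuit.bounded_last_iff.2 ⟨hw, hd⟩
  obtain ⟨S, hS, hinp, W, hW, hev⟩ := (Circuit.hasWeightedSat_iff hb).1 hsat
  simp only at hx hS
  obtain ⟨x, k⟩ := y
  simp only at hx hS ⊢
  subst hx
  have hn := C.nodes_encode
  let A : ℕ → ℕ := fun t => if t = 0 then 0 else
    if ht : t - 1 < k then S.orderEmbOfFin hS ⟨t - 1, ht⟩ + 1 else C.last + 2
  have A0 : A 0 = 0 := rfl
  have Amid : ∀ t (ht : t < k), A (t + 1) = S.orderEmbOfFin hS ⟨t, ht⟩ + 1 := fun t ht => by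
    simp [A, ht]
  have Alast : A (k + 1) = C.last + 2 := by simp [A]
  have Amono : ∀ s t, s < t → t < k + 2 → A s < A t := by
    intro s t hst ht
    obtain ⟨t, rfl⟩ : ∃ t', t = t' + 1 := ⟨t - 1, by omega⟩
    rcases Nat.eq_zero_or_pos s with rfl | hs
    · rw [A0]
      rcases lt_or_ge t k with htk | htk
      · rw [Amid t htk]; omega
      · rw [show t = k by omega, Alast]; omega
    · obtain ⟨s, rfl⟩ : ∃ s', s = s' + 1 := ⟨s - 1, by omega⟩
      rw [Amid s (by omega)]
      rcases lt_or_ge t k with htk | htk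
      · rw [Amid t htk]
        have : S.orderEmbOfFin hS ⟨s, by omega⟩ < S.orderEmbOfFin hS ⟨t, htk⟩ := by
          rw [OrderEmbedding.lt_iff_lt, Fin.mk_lt_mk]; omega
        exact Nat.succ_lt_succ this
      · have htl : A (t + 1) = C.last + 2 := by rw [← Alast, show t = k by omega]
        rw [htl]; omega
  have Alt : ∀ s t, s < k + 2 → t < k + 2 → A s < A t → s < t := by
    intro s t hs ht hst
    rcases lt_trichotomy s t with hlt | rfl | hgt
    · exact hlt
    · omega
    · have := Amono t s hgt hs; omega
  have Ale : ∀ t < k + 2, A t ≤ C.last + 1 + 1 := by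
    intro t ht
    rw [← Alast]
    rcases Nat.lt_succ_iff_lt_or_eq.1 ht with hlt | rfl
    · exact (Amono t (k + 1) hlt (by omega)).le
    · exact le_rfl
  have Amem : ∀ t < k, ∃ z ∈ S, A (t + 1) = z.1 + 1 := fun t ht =>
    ⟨_, S.orderEmbOfFin_mem hS ⟨t, ht⟩, Amid t ht⟩
  have memA : ∀ z ∈ S, ∃ t < k, A (t + 1) = z.1 + 1 := by
    intro z hz
    have : z ∈ Set.range (S.orderEmbOfFin hS) := by rw [S.range_orderEmbOfFin hS]; exact hz
    obtain ⟨t, rfl⟩ := this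
    exact ⟨t, t.2, Amid t t.2⟩
  -- The padding value 0 chooses no node.
  obtain ⟨c, hc1, hc2⟩ := exists_enumeration (W.image fun z => z.1 + 1)
    (Finset.card_image_le.trans hW) 0
  have hc3 : ∀ i < 2 ^ h, c i ≤ C.last + 1 := by
    intro i _
    rcases hc2 i with hi | hi
    · obtain ⟨z, -, hz⟩ := Finset.mem_image.1 hi
      omega
    · omega
  have hex : ∀ σ : Fin Q → Fin (k + 2), ∃ v < digitBase ⟨C.encode, k⟩ ^ (2 * Q + 2 ^ h),
      (∀ i : Fin Q, slot ⟨C.encode, k⟩ v i = σ i) ∧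
      (∀ i : Fin Q, val Q ⟨C.encode, k⟩ v i = A (σ i)) ∧
      ∀ i < 2 ^ h, choice Q ⟨C.encode, k⟩ v i = c i := by
    intro σ
    obtain ⟨v, h1, h2, h3, h4⟩ := exists_vertex (Q := Q) (R := 2 ^ h) (y := ⟨C.encode, k⟩)
      (s := fun i => if hi : i < Q then σ ⟨i, hi⟩ else 0) (A := A) (c := c)
      (fun i hi => by simp [hi]) (by simpa only [hn] using Ale) (by simpa only [hn] using hc3)
    refine ⟨v, h1, fun i => ?_, fun i => ?_, h4⟩
    · simpa using h2 i i.2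
    · simpa using h3 i i.2
  choose V hV1 hV2 hV3 hV4 using hex
  have hinj : Function.Injective V := by
    intro σ τ hστ
    ext i
    rw [← hV2, hστ, hV2]
  have hvalid : ∀ σ, ValidVertex h Q (2 ^ h) ⟨C.encode, k⟩ (V σ) := by
    intro σ
    refine ⟨wellFormed_iff.2 ⟨C, rfl, hb⟩, hV1 σ, fun i hi => ?_, fun i hi j hj => ?_, ?_⟩
    · rw [hV2 σ ⟨i, hi⟩, hV3 σ ⟨i, hi⟩]
      simp only [hn]
      refine ⟨(σ ⟨i, hi⟩).2, fun h0 => by rw [h0, A0], fun h0 => by rw [h0, Alast],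
        fun h0 h1 => ?_⟩
      obtain ⟨t, ht⟩ : ∃ t, (σ ⟨i, hi⟩).1 = t + 1 := ⟨(σ ⟨i, hi⟩).1 - 1, by omega⟩
      have := (σ ⟨i, hi⟩).2
      obtain ⟨z, hz, hAz⟩ := Amem t (by omega)
      rw [ht, hAz]
      refine ⟨by omega, by omega, ?_⟩
      rw [Nat.add_sub_cancel, C.kindAt_encode, hinp z hz]
    · rw [hV2 σ ⟨i, hi⟩, hV3 σ ⟨i, hi⟩, hV2 σ ⟨j, hj⟩, hV3 σ ⟨j, hj⟩]
      exact ⟨fun hlt => Amono _ _ hlt (σ ⟨j, hj⟩).2, fun heq => by rw [heq]⟩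
    · simp only [hn, Nat.add_sub_cancel]
      refine (C.evAt_encode (Fin.last C.last)).2 (hev.mono (fun z hz => ?_) fun b z _ hz => ?_)
      · obtain ⟨i, hi, hci⟩ := hc1 (z.1 + 1) (Finset.mem_image_of_mem _ hz)
        exact ⟨i, hi, by rw [hV4 σ i hi, hci]⟩
      · refine ⟨?_, ?_⟩
        -- A true input is the content of some slot, and `A` is increasing, so it cannot fall
        -- strictly between two adjacent slots.
        · rintro hbt ⟨i, hi, j, hj, h1, h2, h3⟩
          obtain ⟨t, ht, hAt⟩ := memA z (hz.2 hbt)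
          rw [hV3 σ ⟨i, hi⟩, ← hAt] at h2
          rw [hV3 σ ⟨j, hj⟩, ← hAt] at h3
          rw [hV2 σ ⟨i, hi⟩, hV2 σ ⟨j, hj⟩] at h1
          have := Alt _ _ (σ _).2 (by omega) h2
          have := Alt _ _ (by omega) (σ _).2 h3
          omega
        · rintro hbf ⟨i, hi, h1⟩
          rw [hV3 σ ⟨i, hi⟩] at h1
          have hzS : z ∉ S := fun hzS => by simp [hbf, hz] at hzS
          have hσ := (σ ⟨i, hi⟩).2
          have hz' := z.2
          generalize (σ ⟨i, hi⟩).1 = t at h1 hσ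
          rcases Nat.eq_zero_or_pos t with rfl | htpos
          · omega
          obtain ⟨t, rfl⟩ : ∃ t', t = t' + 1 := ⟨t - 1, by omega⟩
          rcases lt_or_ge t k with htk | htk
          · obtain ⟨z', hz'S, hAz'⟩ := Amem t htk
            exact hzS (by rwa [show z = z' from Fin.ext (by omega)])
          · rw [show t = k by omega, Alast] at h1
            omega
  refine ⟨Finset.univ.image V, ?_, ?_, ?_⟩
  · rw [Finset.card_image_of_injective _ hinj]
    simp
  · intro v hv
    obtain ⟨σ, -, rfl⟩ := Finset.mem_image.1 hv
    exact hV1 σ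
  · intro u hu v hv huv
    obtain ⟨σ, -, rfl⟩ := Finset.mem_image.1 hu
    obtain ⟨τ, -, rfl⟩ := Finset.mem_image.1 hv
    rcases huv with ⟨hne, h1 | h1 | h1 | ⟨i, hi, h1⟩ | ⟨i, hi, j, hj, h1, h2⟩⟩
    · exact h1 (hvalid σ)
    · exact h1 (hvalid τ)
    · refine hne (congrArg V ?_)
      ext i
      rw [← hV2, h1 i i.2, hV2]
    · exact h1 (by rw [hV4 σ i hi, hV4 τ i hi])
    · rw [hV2 σ ⟨i, hi⟩, hV2 τ ⟨j, hj⟩] at h1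
      rw [hV3 σ ⟨i, hi⟩, hV3 τ ⟨j, hj⟩, h1] at h2
      exact h2 rfl

/-! ### From an independent set to a satisfying assignment -/

/-- A large independent set contains a vertex for every tuple of slots. -/
theorem exists_vertex_of_independent (hQ : 0 < Q) {I : Finset ℕ}
    (hI : (y.param + 2) ^ Q ≤ I.card) (hadj : ∀ u ∈ I, ∀ v ∈ I, ¬ AdjAt h Q R y u v) :
    (∀ v ∈ I, ValidVertex h Q R y v) ∧ (∀ u ∈ I, ∀ v ∈ I, u ≠ v → ¬ Conflict Q R y u v) ∧
      ∀ τ : ℕ → ℕ, (∀ i < Q, τ i < y.param + 2) → ∃ v ∈ I, ∀ i < Q, slot y v i = τ i := by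
  classical
  -- With two elements in `I`, invalid vertices are excluded.
  have hcard : 1 < I.card := by
    refine lt_of_lt_of_le ?_ hI
    exact Nat.one_lt_pow hQ.ne' (by omega)
  have hvalid : ∀ v ∈ I, ValidVertex h Q R y v := by
    intro v hv
    obtain ⟨u, hu, huv⟩ := Finset.exists_mem_ne hcard v
    by_contra hvv
    exact hadj u hu v hv ⟨huv, Or.inr (Or.inl hvv)⟩
  have hconf : ∀ u ∈ I, ∀ v ∈ I, u ≠ v → ¬ Conflict Q R y u v := fun u hu v hv huv hc =>
    hadj u hu v hv ⟨huv, Or.inr (Or.inr hc)⟩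
  refine ⟨hvalid, hconf, fun τ hτ => ?_⟩
  let σ : I → Fin Q → Fin (y.param + 2) := fun v i =>
    ⟨slot y v i, ((hvalid v v.2).2.2.1 i i.2).1⟩
  have hσ : Function.Injective σ := by
    intro u v huv
    by_contra hne
    refine hconf u u.2 v v.2 (fun h => hne (Subtype.ext h)) (Or.inl fun i hi => ?_)
    simpa [σ] using congrFun huv ⟨i, hi⟩
  -- Independence makes the map to slot tuples injective, and `I` has at least as many elements as
  -- there are tuples.
  have hbij : Function.Bijective σ := by
    rw [Fintype.bijective_iff_injective_and_card]
    refine ⟨hσ, le_antisymm (Fintype.card_le_of_injective σ hσ) ?_⟩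
    simpa using hI
  obtain ⟨v, hv⟩ := hbij.2 fun i => ⟨τ i, hτ i i.2⟩
  exact ⟨v, v.2, fun i hi => by simpa [σ] using congrFun hv ⟨i, hi⟩⟩

/-- The vertices glue to one list `A` and one set `W`. If these gave no proof that the output is
true, few inputs would be to blame; the vertex whose slots show the values of these inputs would
then be refuted as well, although it is valid. -/
theorem mem_of_independent {I : Finset ℕ}
    (hI : (y.param + 2) ^ (2 * (2 ^ h + 2) ^ h) ≤ I.card)
    (hadj : ∀ u ∈ I, ∀ v ∈ I, ¬ AdjAt h (2 * (2 ^ h + 2) ^ h) (2 ^ h) y u v) :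
    (y.word, y.param) ∈ weightedCircuitSat 1 h := by
  classical
  have hQ2 : 2 ≤ 2 * (2 ^ h + 2) ^ h := by
    have : 0 < (2 ^ h + 2) ^ h := by positivity
    omega
  generalize hQ : 2 * (2 ^ h + 2) ^ h = Q at *
  generalize hR : 2 ^ h = R at *
  obtain ⟨hvalid, hconf, hall⟩ := exists_vertex_of_independent (by omega) hI hadj
  have hval : ∀ u ∈ I, ∀ v ∈ I, ∀ i < Q, ∀ j < Q, slot y u i = slot y v j →
      val Q y u i = val Q y v j := by
    intro u hu v hv i hi j hj hs
    by_cases huv : u = v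
    · subst huv
      exact ((hvalid u hu).2.2.2.1 i hi j hj).2 hs
    · by_contra hne
      exact hconf u hu v hv huv (Or.inr (Or.inr ⟨i, hi, j, hj, hs, hne⟩))
  obtain ⟨v₀, hv₀, -⟩ := hall (fun _ => 0) fun _ _ => by omega
  have hchoice : ∀ v ∈ I, ∀ i < R, choice Q y v i = choice Q y v₀ i := by
    intro v hv i hi
    by_cases hvv : v = v₀
    · rw [hvv]
    · by_contra hne
      exact hconf v hv v₀ hv₀ hvv (Or.inr (Or.inl ⟨i, hi, hne⟩))
  obtain ⟨C, hx, hb⟩ := wellFormed_iff.1 (hvalid v₀ hv₀).1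
  obtain ⟨x, k⟩ := y
  simp only at hx hall hI ⊢
  subst hx
  have hn := C.nodes_encode
  set y : Inst := ⟨C.encode, k⟩ with hy
  obtain ⟨A, hA⟩ : ∃ A : ℕ → ℕ, ∀ v ∈ I, ∀ i < Q, val Q y v i = A (slot y v i) := by
    have : ∀ s, ∃ a, ∀ v ∈ I, ∀ i < Q, slot y v i = s → val Q y v i = a := by
      intro s
      by_cases hs : ∃ v ∈ I, ∃ i < Q, slot y v i = s
      · obtain ⟨v, hv, i, hi, hvi⟩ := hs
        exact ⟨val Q y v i, fun u hu j hj huj => hval u hu v hv j hj i hi (huj.trans hvi.symm)⟩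
      · exact ⟨0, fun v hv i hi hvi => absurd ⟨v, hv, i, hi, hvi⟩ hs⟩
    choose A hA using this
    exact ⟨A, fun v hv i hi => hA _ v hv i hi rfl⟩
  have Aspec : ∀ s < k + 2, (s = 0 → A s = 0) ∧ (s = k + 1 → A s = C.last + 2) ∧
      (s ≠ 0 → s ≠ k + 1 → A s ≠ 0 ∧ A s ≤ C.last + 1 ∧ kindAt C.encode (A s - 1) = .input) := by
    intro s hs
    obtain ⟨v, hv, hvs⟩ := hall (fun _ => s) fun _ _ => hs
    have := ((hvalid v hv).2.2.1 0 (by omega)).2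
    rw [hA v hv 0 (by omega), hvs 0 (by omega)] at this
    simpa only [hy, hn] using this
  have Amono : ∀ s t, s < t → t < k + 2 → A s < A t := by
    intro s t hst ht
    -- Two slots have to be visible in one vertex, which is why `Q` must be at least 2.
    obtain ⟨v, hv, hvs⟩ := hall (fun i => if i = 0 then s else t) fun i _ => by
      split_ifs <;> omega
    have := ((hvalid v hv).2.2.2.1 0 (by omega) 1 (by omega)).1
    rw [hA v hv 0 (by omega), hA v hv 1 (by omega), hvs 0 (by omega), hvs 1 (by omega)] at this
    simpa using this (by simpa using hst)
  have A0 := (Aspec 0 (by omega)).1 rfl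
  have Alast := (Aspec (k + 1) (by omega)).2.1 rfl
  have Amid : ∀ t < k, A (t + 1) ≠ 0 ∧ A (t + 1) ≤ C.last + 1 ∧
      kindAt C.encode (A (t + 1) - 1) = .input := fun t ht =>
    (Aspec (t + 1) (by omega)).2.2 (by omega) (by omega)
  let e : Fin k → Fin (C.last + 1) := fun t =>
    ⟨A (t + 1) - 1, by have := Amid t t.2; omega⟩
  have he : Function.Injective e := by
    intro s t hst
    have hst : A (s + 1) - 1 = A (t + 1) - 1 := congrArg Fin.val hst
    have h1 := Amid s s.2
    have h2 := Amid t t.2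
    ext
    rcases lt_trichotomy s.1 t.1 with hlt | heq | hgt
    · have := Amono (s + 1) (t + 1) (by omega) (by omega); omega
    · exact heq
    · have := Amono (t + 1) (s + 1) (by omega) (by omega); omega
  let S : Finset (Fin (C.last + 1)) := Finset.univ.image e
  have hS : ∀ z : Fin (C.last + 1), z ∈ S ↔ ∃ t < k, A (t + 1) = z.1 + 1 := by
    intro z
    simp only [S, Finset.mem_image, Finset.mem_univ, true_and]
    constructor
    · rintro ⟨t, rfl⟩
      have := Amid t t.2
      exact ⟨t, t.2, by simp only [e]; omega⟩
    · rintro ⟨t, ht, hAt⟩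
      exact ⟨⟨t, ht⟩, Fin.ext (by simp only [e]; omega)⟩
  let W : Finset (Fin (C.last + 1)) := {z : Fin (C.last + 1) | Chosen Q R y v₀ z}
  have hW : W.card ≤ R := by
    have : W.card ≤ ((Finset.range R).image (choice Q y v₀)).card := by
      refine Finset.card_le_card_of_injOn (fun z => z.1 + 1) (fun z hz => ?_)
        fun z _ z' _ hzz => Fin.ext (Nat.succ_injective hzz)
      obtain ⟨i, hi, hiz⟩ := (Finset.mem_filter.1 hz).2
      exact Finset.mem_coe.2 (Finset.mem_image.2 ⟨i, Finset.mem_range.2 hi, hiz⟩)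
    exact this.trans (Finset.card_image_le.trans (by simp))
  -- These slots reveal the value of `z`: `p` alone if it is true, with a dummy `q`, and otherwise
  -- the adjacent slots around it, found from the least `t` with `z.1 + 1 ≤ A t`.
  have hslots : ∀ z : Fin (C.last + 1), ∃ p q, p < k + 2 ∧ q < k + 2 ∧
      (z ∈ S ∧ A p = z.1 + 1 ∨ z ∉ S ∧ q = p + 1 ∧ A p < z.1 + 1 ∧ z.1 + 1 < A q) := by
    intro z
    by_cases hz : z ∈ S
    · obtain ⟨t, ht, hAt⟩ := (hS z).1 hz
      exact ⟨t + 1, 0, by omega, by omega, Or.inl ⟨hz, hAt⟩⟩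
    have hex : ∃ t, z.1 + 1 ≤ A t ∧ t ≤ k + 1 := ⟨k + 1, by have := z.2; omega, le_rfl⟩
    obtain ⟨h1, h2⟩ := Nat.find_spec hex
    have hmin := fun s (hs : s < Nat.find hex) => Nat.find_min hex hs
    generalize Nat.find hex = t at h1 h2 hmin
    have ht0 : t ≠ 0 := by rintro rfl; omega
    obtain ⟨s, rfl⟩ : ∃ s, t = s + 1 := ⟨t - 1, by omega⟩
    have h3 := hmin s (by omega)
    refine ⟨s, s + 1, by omega, by omega, Or.inr ⟨hz, rfl, by omega, ?_⟩⟩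
    refine lt_of_le_of_ne h1 fun heq => ?_
    rcases lt_or_ge s k with hsk | hsk
    · exact hz ((hS z).2 ⟨s, hsk, heq.symm⟩)
    · rw [show s = k by omega, Alast] at heq
      have := z.2
      omega
  choose p q hp hq hpq using hslots
  obtain ⟨hwd⟩ : Nonempty (C.WeftLE 1 ∧ C.DepthLE h) := ⟨Circuit.bounded_last_iff.1 hb⟩
  refine ⟨C, hwd.1, hwd.2, rfl, (Circuit.hasWeightedSat_iff hb).2 ⟨S, ?_, ?_, W, ?_, ?_⟩⟩
  · rw [Finset.card_image_of_injective _ he]; simp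
  · intro z hz
    obtain ⟨t, ht, hAt⟩ := (hS z).1 hz
    have := (Amid t ht).2.2
    rwa [hAt, Nat.add_sub_cancel, C.kindAt_encode] at this
  · rwa [hR]
  by_contra hev
  obtain ⟨X, -, hXcard, hX⟩ := Circuit.exists_finset_of_not_ev (R := R)
    (by rw [← Set.ncard_coe_finset W] at hW; exact hW) hev
  -- Two slots for every input in `X` account for the factor 2 in `Q`.
  obtain ⟨τ, hτ1, hτ2⟩ := exists_enumeration (Q := Q) (X.image p ∪ X.image q) (by
    refine (Finset.card_union_le _ _).trans ?_
    have h1 : (X.image p).card ≤ X.card := Finset.card_image_le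
    have h2 : (X.image q).card ≤ X.card := Finset.card_image_le
    omega) 0
  obtain ⟨v, hv, hvτ⟩ := hall τ fun i _ => by
    rcases hτ2 i with hi | hi
    · rcases Finset.mem_union.1 hi with hi | hi
      · obtain ⟨z, -, hz⟩ := Finset.mem_image.1 hi
        rw [← hz]; exact hp z
      · obtain ⟨z, -, hz⟩ := Finset.mem_image.1 hi
        rw [← hz]; exact hq z
    · omega
  have hevv := (hvalid v hv).2.2.2.2
  simp only [hy, hn, Nat.add_sub_cancel] at hevv
  have hevv := (C.evAt_encode (Fin.last C.last)).1 hevv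
  -- On `X` the vertex `v` allows only the values given by `S`, so its own proof contradicts the
  -- choice of `X`.
  refine hX (fun b i => MayBe Q y v b i) (fun z hz b hzb => ?_)
    (hevv.mono (fun i hi => ?_) fun _ _ _ h => h)
  · obtain ⟨i, hi, hiz⟩ := hτ1 (p z) (Finset.mem_union_left _ (Finset.mem_image_of_mem _ hz))
    obtain ⟨j, hj, hjz⟩ := hτ1 (q z) (Finset.mem_union_right _ (Finset.mem_image_of_mem _ hz))
    have hsi := hvτ i hi
    have hsj := hvτ j hj
    have hvi := hA v hv i hi
    have hvj := hA v hv j hj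
    rw [hsi, hiz] at hvi
    rw [hsj, hjz] at hvj
    rcases hpq z with ⟨hzS, hAp⟩ | ⟨hzS, hpq', h1, h2⟩
    · cases b
      · exact absurd ⟨i, hi, by rw [hvi, hAp]⟩ (hzb.2 rfl)
      · simpa using hzS
    · cases b
      · simpa using hzS
      · exact absurd ⟨i, hi, j, hj, by rw [hsi, hsj, hiz, hjz, hpq'], by rw [hvi]; exact h1,
          by rw [hvj]; exact h2⟩ (hzb.1 rfl)
  · obtain ⟨i', hi', hci⟩ := hi
    refine Finset.mem_filter.2 ⟨Finset.mem_univ _, i', hi', ?_⟩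
    rw [← hci]
    exact (hchoice v hv i' hi').symm

end Correctness

/-! ## The reduction -/

/-- Since the matching is perfect, 2|M| counts the vertices, and vertex covers are the complements
of independent sets. -/
theorem vertexGraph_mem_VCU2_iff {h Q R k : ℕ} {y : Inst} (hk : 0 < k) :
    (encodeVCU2 (vertexGraph h Q R y) (vertexMatching h Q R y), k) ∈ VCU2 ↔
      ∃ I : Finset ℕ, k ≤ I.card ∧ (∀ v ∈ I, v < 2 * digitBase y ^ (2 * Q + R)) ∧
        ∀ u ∈ I, ∀ v ∈ I, ¬ AdjAt h Q R y u v := by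
  classical
  constructor
  · rintro ⟨-, n, G, M, -, henc, C, hC, hcard⟩
    obtain ⟨rfl, hG, hM⟩ := encodeVCU2_injective henc
    simp only [Fin.cast_eq_self] at hG hM
    have hedge : M.edgeSet = (vertexMatching h Q R y).edgeSet := by
      ext z
      induction z with | _ u v
      simp only [SimpleGraph.Subgraph.mem_edgeSet, hM]
    rw [hedge, ncard_edgeSet_vertexMatching] at hcard
    refine ⟨Cᶜ.map Fin.valEmbedding, ?_, fun v hv => ?_, fun u hu v hv huv => ?_⟩
    · rw [Finset.card_map, Finset.card_compl, Fintype.card_fin]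
      simp only at hcard
      omega
    · obtain ⟨v, -, rfl⟩ := Finset.mem_map.1 hv
      exact v.2
    · obtain ⟨u, hu', rfl⟩ := Finset.mem_map.1 hu
      obtain ⟨v, hv', rfl⟩ := Finset.mem_map.1 hv
      rcases hC ((hG u v).2 huv) with h' | h'
      · exact Finset.mem_compl.1 hu' h'
      · exact Finset.mem_compl.1 hv' h'
  · rintro ⟨I, hI, hlt, hadj⟩
    refine ⟨hk, _, _, _, isMaximalMatching_vertexMatching h Q R y, rfl,
      Finset.univ.filter fun v => v.1 ∉ I, fun u v huv => ?_, ?_⟩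
    · simp only [Finset.coe_filter, Finset.mem_univ, true_and, Set.mem_ofPred_eq]
      by_contra! hcon
      exact hadj u hcon.1 v hcon.2 huv
    · rw [ncard_edgeSet_vertexMatching]
      have h1 := Finset.card_filter_add_card_filter_not
        (s := (Finset.univ : Finset (Fin (2 * digitBase y ^ (2 * Q + R))))) (fun v => v.1 ∈ I)
      have h2 : I.card ≤ ({v : Fin (2 * digitBase y ^ (2 * Q + R)) | v.1 ∈ I} : Finset _).card := by
        rw [← Finset.card_map Fin.valEmbedding]
        exact Finset.card_le_card fun v hv =>
          Finset.mem_map.2 ⟨⟨v, hlt v hv⟩, by simpa using hv, rfl⟩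
      rw [Finset.card_univ, Fintype.card_fin] at h1
      simp only
      omega

theorem mem_weightedCircuitSat_iff (h : ℕ) (y : Inst) :
    (y.word, y.param) ∈ weightedCircuitSat 1 h ↔
      (encodeVCU2 (vertexGraph h (2 * (2 ^ h + 2) ^ h) (2 ^ h) y)
        (vertexMatching h (2 * (2 ^ h + 2) ^ h) (2 ^ h) y),
        (y.param + 2) ^ (2 * (2 ^ h + 2) ^ h)) ∈ VCU2 := by
  rw [vertexGraph_mem_VCU2_iff (Nat.pow_pos (by omega))]
  constructor
  · intro hy
    obtain ⟨I, h1, h2, h3⟩ := exists_independent_of_mem (Q := 2 * (2 ^ h + 2) ^ h) hy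
    exact ⟨I, h1.ge, fun v hv => (h2 v hv).trans_le (Nat.le_mul_of_pos_left _ (by omega)), h3⟩
  · rintro ⟨I, h1, -, h3⟩
    exact mem_of_independent h1 h3

/-! ### The graph is computable in polynomial time -/

section PolyTime

open Ctx

variable {α : Type} [Ctx α] {f g : α → ℕ}

theorem polyTime_digitBase : PolyTime fun a : α => digitBase (inst a) :=
  (polyTime_nodes.add .param).add (.const 2)

/-- The position i is a constant, so the power of the base stays polynomially bounded. -/
theorem polyTime_digit (hf : PolyTime f) (i : ℕ) : PolyTime fun a => digit (inst a) (f a) i :=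
  (hf.div (polyTime_digitBase.pow i)).mod polyTime_digitBase

theorem polyTime_slot (hf : PolyTime f) (i : ℕ) : PolyTime fun a => slot (inst a) (f a) i :=
  polyTime_digit hf i

theorem polyTime_val (Q : ℕ) (hf : PolyTime f) (i : ℕ) :
    PolyTime fun a => val Q (inst a) (f a) i :=
  polyTime_digit hf _

theorem polyTime_choice (Q : ℕ) (hf : PolyTime f) (i : ℕ) :
    PolyTime fun a => choice Q (inst a) (f a) i :=
  polyTime_digit hf _

theorem polyDec_chosen (Q R : ℕ) (hf : PolyTime f) (hg : PolyTime g) :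
    PolyDec fun a => Chosen Q R (inst a) (f a) (g a) :=
  .bex_const R fun i _ => .eq (polyTime_choice Q hf i) (hg.add (.const 1))

theorem polyDec_mayBe (Q : ℕ) (b : Bool) (hf : PolyTime f) (hg : PolyTime g) :
    PolyDec fun a => MayBe Q (inst a) (f a) b (g a) :=
  have h1 : PolyDec fun a => KnownFalse Q (inst a) (f a) (g a) :=
    .bex_const Q fun i _ => .bex_const Q fun j _ =>
      (PolyDec.eq (polyTime_slot hf j) ((polyTime_slot hf i).add (.const 1))).and
        ((PolyDec.lt (polyTime_val Q hf i) (hg.add (.const 1))).and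
          (.lt (hg.add (.const 1)) (polyTime_val Q hf j)))
  have h2 : PolyDec fun a => KnownTrue Q (inst a) (f a) (g a) :=
    .bex_const Q fun i _ => .eq (polyTime_val Q hf i) (hg.add (.const 1))
  ((PolyDec.const _).imp h1.not).and ((PolyDec.const _).imp h2.not)

theorem polyDec_validVertex (h Q R : ℕ) (hf : PolyTime f) :
    PolyDec fun a => ValidVertex h Q R (inst a) (f a) := by
  have hs := fun i => polyTime_slot hf i
  have hv := fun i => polyTime_val Q hf i
  refine (polyDec_wellFormed h).and ((PolyDec.lt hf (polyTime_digitBase.pow _)).and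
    ((PolyDec.ball_const Q fun i _ => ?_).and ((PolyDec.ball_const Q fun i _ =>
      .ball_const Q fun j _ => ?_).and
      (polyDec_evAt (W := Chosen Q R) (base := MayBe Q) (polyDec_chosen Q R) (polyDec_mayBe Q)
        h true hf (polyTime_nodes.sub (.const 1))))))
  · have hlast : PolyTime fun a : α => (inst a).param + 1 := PolyTime.param.add (.const 1)
    exact (PolyDec.lt (hs i) (PolyTime.param.add (.const 2))).and
      (((PolyDec.eq (hs i) (.const 0)).imp (.eq (hv i) (.const 0))).and
      (((PolyDec.eq (hs i) hlast).imp (.eq (hv i) (polyTime_nodes.add (.const 1)))).and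
      ((PolyDec.eq (hs i) (.const 0)).not.imp ((PolyDec.eq (hs i) hlast).not.imp
        ((PolyDec.eq (hv i) (.const 0)).not.and ((PolyDec.le (hv i) polyTime_nodes).and
          (polyDec_kindAt ((hv i).sub (.const 1)) _)))))))
  · exact ((PolyDec.lt (hs i) (hs j)).imp (.lt (hv i) (hv j))).and
      ((PolyDec.eq (hs i) (hs j)).imp (.eq (hv i) (hv j)))

theorem polyDec_conflict (Q R : ℕ) (hf : PolyTime f) (hg : PolyTime g) :
    PolyDec fun a => Conflict Q R (inst a) (f a) (g a) :=
  (PolyDec.ball_const Q fun i _ => .eq (polyTime_slot hf i) (polyTime_slot hg i)).or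
    ((PolyDec.bex_const R fun i _ =>
      (PolyDec.eq (polyTime_choice Q hf i) (polyTime_choice Q hg i)).not).or
    (.bex_const Q fun i _ => .bex_const Q fun j _ =>
      (PolyDec.eq (polyTime_slot hf i) (polyTime_slot hg j)).and
        (PolyDec.eq (polyTime_val Q hf i) (polyTime_val Q hg j)).not))

theorem polyDec_adjAt (h Q R : ℕ) (hf : PolyTime f) (hg : PolyTime g) :
    PolyDec fun a => AdjAt h Q R (inst a) (f a) (g a) :=
  (PolyDec.eq hf hg).not.and ((polyDec_validVertex h Q R hf).not.or
    ((polyDec_validVertex h Q R hg).not.or (polyDec_conflict Q R hf hg)))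

theorem polyDec_matchAt (Q R : ℕ) (hf : PolyTime f) (hg : PolyTime g) :
    PolyDec fun a => MatchAt Q R (inst a) (f a) (g a) :=
  (PolyDec.eq (hf.add (polyTime_digitBase.pow _)) hg).or
    (.eq (hg.add (polyTime_digitBase.pow _)) hf)

open scoped Classical in
theorem polyWritable_matrix {n : α → ℕ} {P : α → ℕ → ℕ → Prop} (hn : PolyTime n)
    (hP : PolyDec fun q : (α × ℕ) × ℕ => P q.1.1 q.1.2 q.2) :
    PolyWritable fun a => (List.range (n a)).flatMap fun i =>
      (List.range (n a)).map fun j => decide (P a i j) := by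
  simp only [List.map_eq_flatMap]
  exact .flatMap (w := fun a i => (List.range (n a)).flatMap fun j => [decide (P a i j)]) hn
    (.flatMap (w := fun (q : α × ℕ) j => [decide (P q.1 q.2 j)]) hn.fst (.bit hP))

theorem polyWritable_encodeVCU2 (h Q R : ℕ) : PolyWritable fun y : Inst =>
    encodeVCU2 (vertexGraph h Q R y) (vertexMatching h Q R y) := by
  classical
  have hN : PolyTime fun y : Inst => 2 * digitBase y ^ (2 * Q + R) :=
    (PolyTime.const 2).mul (polyTime_digitBase.pow _)
  have h1 : PolyWritable fun y : Inst => encodeNat (2 * digitBase y ^ (2 * Q + R)) := by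
    have := (PolyWritable.flatMap (w := fun _ _ => _) hN (.bit (.const True))).append
      (.bit (.const False))
    simpa [encodeNat, ← List.map_eq_flatMap] using this
  have h2 : PolyWritable fun y : Inst => encodeMatrix (vertexGraph h Q R y).Adj := by
    have e : ∀ y : Inst, encodeMatrix (vertexGraph h Q R y).Adj = _ := fun y =>
      encodeMatrix_eq (R' := AdjAt h Q R y) fun _ _ => Iff.rfl
    simp only [e]
    exact polyWritable_matrix (P := fun y => AdjAt h Q R y) hN
      (polyDec_adjAt h Q R PolyTime.snd.fst .snd)
  have h3 : PolyWritable fun y : Inst => encodeMatrix (vertexMatching h Q R y).Adj := by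
    have e : ∀ y : Inst, encodeMatrix (vertexMatching h Q R y).Adj = _ := fun y =>
      encodeMatrix_eq (R' := MatchAt Q R y) fun _ _ => Iff.rfl
    simp only [e]
    exact polyWritable_matrix (P := fun y => MatchAt Q R y) hN
      (polyDec_matchAt Q R PolyTime.snd.fst .snd)
  exact (h1.append h2).append h3

end PolyTime

theorem theorem3 : WHard 1 VCU2 := by
  rintro P ⟨h, hP⟩
  -- As `h` is fixed by the problem, Q and R are constants: the graph has polynomial size and the
  -- new parameter (k + 2)^Q depends on k only.
  exact hP.trans_polyTime (polyWritable_encodeVCU2 h _ _)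
    ((PolyTime.param.add (.const 2)).pow (2 * (2 ^ h + 2) ^ h)) _ (fun _ => le_rfl)
    (mem_weightedCircuitSat_iff h)
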